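/- Let $\overline{\mathbb C}$ be the Riemann sphere. At a finite point $p$ use the local coordinate $z-p$, and at $p=\infty$ the local coordinate $1/z$; derivatives of maps between subsets of $\overline{\mathbb C}$ are taken in these coordinates. A domain $B\subset\overline{\mathbb C}$ is of hyperbolic type if $\partial B$ is a connected set containing more than one point. For $a\in B$ let $g_B(\cdot,a)$ be the Green function of $B$ with pole $a$ (the least positive harmonic function in $B\setminus\{a\}$ with a logarithmic pole at $a$). The inner radius $r(B,a)$ is defined by $g_B(z,a)=-\log|w|+\log r(B,a)+o(1)$ as $z\to a$, where $w$ is the local coordinate at $a$. Let $\overline{\mathbb C}^\infty$ be the countable product of Riemann spheres, with the topology of coordinatewise convergence uniform in the index of the coordinate, and let $U^\infty=\{W\in\mathbb C^\infty: |w_k|<1\text{ for all }k\}$. A map $F=\{F_k\}$ between subsets of $\overline{\mathbb C}^\infty$ is holomorphic if each component $F_k$ is continuous and has, in local coordinates, continuous partial derivatives in all variables satisfying the Cauchy–Riemann equations. It is biholomorphic if it has an inverse that is holomorphic on its image. A map $G$ on $U^\infty$ is called partially conformal with constant $\delta>0$ if $G(W)=\{\varphi_k(w_k)\}_k$, where each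 $\varphi_k:\{|w|<1\}\to\overline{\mathbb C}$ is holomorphic and injective (a simple pole being allowed) and $\delta<|\varphi_k'(0)|<1/\delta$ for all $k$. **Theorem.** Let $A=\{a_k\}\in\overline{\mathbb C}^\infty$, $0<\delta\le 1$, and let $\mathbb B=B_1\times B_2\times\cdots$, where for every $k$ the set $B_k\subset\overline{\mathbb C}$ is a domain of hyperbolic type with $a_k\in B_k$ and $\delta<r(B_k,a_k)<1/\delta$. Then there are holomorphic injective functions $f_k$ mapping $B_k$ onto the unit disc such that the coordinatewise map $F(Z)=\{f_k(z_k)\}_k$ maps $\mathbb B$ biholomorphically onto $U^\infty$ and is normalized by $F(A)=0$, $F'(A)>0$, that is, $f_k(a_k)=0$ and $f_k'(a_k)>0$ for all $k$. This map is unique among the biholomorphic maps of $\mathbb B$ onto $U^\infty$ of the coordinatewise form $\{g_k(z_k)\}_k$ with the same normalization. Its inverse is a partially conformal map of $U^\infty$ with constant $\delta$. -/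

import Mathlib

namespace Polycylindrical

open Topology Filter

/-! ### The Riemann sphere -/

/-- The Riemann sphere, with its usual (compact) topology. -/
abbrev Sphere : Type := OnePoint ℂ

/-- The standard local parametrization of the sphere centred at `p`, with `param p 0 = p`:
`w ↦ p + w` at a finite point, and `w ↦ 1 / w` (with `0 ↦ ∞`) at the point `∞`. -/
noncomputable def param : Sphere → ℂ → Sphere
  | some a => fun w => ((a + w : ℂ) : Sphere)
  | none => fun w => if w = 0 then OnePoint.infty else ((w⁻¹ : ℂ) : Sphere)

/-- The standard local coordinate centred at `p`, the local inverse of `param p`: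
`z ↦ z - p` at a finite point `p`, and `z ↦ 1 / z` (with `∞ ↦ 0`) at `p = ∞`.
The value at the one point outside the chart is irrelevant and set to `0`
(the point `∞` if `p` is finite, the point `0` if `p = ∞`). -/
noncomputable def coord : Sphere → Sphere → ℂ
  | some _, none => 0
  | some a, some z => z - a
  | none, none => 0
  | none, some z => z⁻¹

/-- `f` is holomorphic at `p` as a map of the Riemann sphere to itself: it is continuous there and
is differentiable at the centre in the standard coordinates at `p` and at `f p`. -/
def HolomorphicAtPt (f : Sphere → Sphere) (p : Sphere) : Prop :=
  ContinuousAt f p ∧ DifferentiableAt ℂ (fun w : ℂ => coord (f p) (f (param p w))) 0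

/-- The derivative of `f` at `p` in the standard coordinates centred at `p` and at `f p`
(the ordinary derivative when both points are finite). -/
noncomputable def sphereDeriv (f : Sphere → Sphere) (p : Sphere) : ℂ :=
  deriv (fun w : ℂ => coord (f p) (f (param p w))) 0

/-- `f` is holomorphic and univalent in `B`. -/
def UnivalentOn (f : Sphere → Sphere) (B : Set Sphere) : Prop :=
  (∀ p ∈ B, HolomorphicAtPt f p) ∧ Set.InjOn f B

/-- The open unit disc, as a subset of the sphere. -/
def unitDisc : Set Sphere := ((↑) : ℂ → Sphere) '' Metric.ball (0 : ℂ) 1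

/-- A domain of hyperbolic type: a domain of the sphere whose boundary is connected and contains
more than one point. -/
structure IsHyperbolicType (B : Set Sphere) : Prop where
  isOpen : IsOpen B
  isConnected : IsConnected B
  boundary_connected : IsPreconnected (frontier B)
  boundary_nontrivial : (frontier B).Nontrivial

/-! ### Green function and inner radius -/

/-- `h` is a positive harmonic function in `B ∖ {a}` with the logarithmic singularity
`- log |w| + (harmonic function)` at `a`, where `w` is the standard coordinate at `a`. -/
structure IsPositiveWithLogPole (B : Set Sphere) (a : Sphere) (h : Sphere → ℝ) : Prop where
  harmonic : ∀ p ∈ B \ {a}, InnerProductSpace.HarmonicAt (fun w : ℂ => h (param p w)) 0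
  pos : ∀ p ∈ B \ {a}, 0 < h p
  pole : ∃ u : ℂ → ℝ, InnerProductSpace.HarmonicAt u 0 ∧
    ∀ᶠ w in 𝓝[≠] (0 : ℂ), h (param a w) = u w - Real.log ‖w‖

/-- The (generalized) Green function `g_B(p, a)` of `B` with pole at `a`: the least positive
harmonic function in `B ∖ {a}` with a logarithmic pole at `a`. It is meaningful for those domains
that possess a Green function, in particular for all domains of hyperbolic type. -/
noncomputable def greenFunction (B : Set Sphere) (a p : Sphere) : ℝ :=
  sInf {x : ℝ | ∃ h : Sphere → ℝ, IsPositiveWithLogPole B a h ∧ x = h p}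

/-- The inner radius `r(B, a)`, given by the expansion
`g_B(z, a) = - log |w| + log r(B, a) + o(1)` as `z → a`, where `w` is the standard
coordinate at `a` (`w = z - a`, and `w = 1 / z` if `a = ∞`). -/
noncomputable def innerRadius (B : Set Sphere) (a : Sphere) : ℝ :=
  Real.exp (limUnder (𝓝[≠] (0 : ℂ))
    (fun w : ℂ => greenFunction B a (param a w) + Real.log ‖w‖))

/-! ### The infinite product of spheres -/

/-- The countable product of Riemann spheres. The space of complex sequences is contained in it. -/
def SphereProd : Type := ℕ → Sphere

/-- The topology of coordinatewise convergence that is uniform in the index of the coordinate; the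
sphere carries the unique uniform structure compatible with its compact topology. -/
noncomputable instance : TopologicalSpace SphereProd :=
  letI : UniformSpace Sphere := uniformSpaceOfCompactR1
  TopologicalSpace.induced (fun Z : ℕ → Sphere => UniformFun.ofFun Z)
    (inferInstance : TopologicalSpace (UniformFun ℕ Sphere))

/-- The point obtained from `Z` by replacing the `p`-th coordinate with `t`. -/
noncomputable def SphereProd.replace (Z : SphereProd) (p : ℕ) (t : Sphere) : SphereProd :=
  Function.update (β := fun _ => Sphere) Z p t

/-- The product `B_0 × B_1 × ⋯` of subsets of the sphere. -/
def polycylinder (B : ℕ → Set Sphere) : Set SphereProd := {Z | ∀ k, Z k ∈ B k}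

/-- The open unit polydisc. -/
def unitPolydisc : Set SphereProd := polycylinder (fun _ => unitDisc)

/-- The coordinatewise map `Z ↦ (f_k(z_k))_k`. -/
def coordMap (f : ℕ → Sphere → Sphere) : SphereProd → SphereProd := fun Z k => f k (Z k)

/-- `F` is holomorphic in `D`: each component of `F` is continuous in `D`, has at every point of
`D` a complex partial derivative in each variable (that is, real partial derivatives satisfying the
Cauchy-Riemann equations), and these partial derivatives, taken in the standard coordinates centred
at a point of `D` and at its image, are continuous at that point. -/
structure HolomorphicMapOn (F : SphereProd → SphereProd) (D : Set SphereProd) : Prop where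
  continuousOn : ∀ k, ContinuousOn (fun Z => F Z k) D
  holomorphic : ∀ Z ∈ D, ∀ k p, HolomorphicAtPt (fun t => F (Z.replace p t) k) (Z p)
  continuous_partial : ∀ Z ∈ D, ∀ k p, ContinuousWithinAt
    (fun W : SphereProd =>
      deriv (fun w : ℂ => coord (F Z k) (F (W.replace p (param (Z p) w)) k)) (coord (Z p) (W p)))
    D Z

/-- `G`, defined on `E`, is the inverse of the map `F` of `D` onto `E`. -/
structure IsInverseMap (F G : SphereProd → SphereProd) (D E : Set SphereProd) : Prop where
  mapsTo : Set.MapsTo F D E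
  mapsTo_inv : Set.MapsTo G E D
  invOn : Set.InvOn G F D E

/-- `F` maps `D` biholomorphically onto `E`. -/
def IsBiholomorphic (F : SphereProd → SphereProd) (D E : Set SphereProd) : Prop :=
  HolomorphicMapOn F D ∧ ∃ G, IsInverseMap F G D E ∧ HolomorphicMapOn G E

/-- Normalization of the coordinatewise map `F = (f_k)` at `A = (a_k)`:
`F(A) = 0` and `F'(A) > 0`, that is `f_k(a_k) = 0` and `f_k'(a_k) > 0` for all `k`. -/
def IsNormalizedAt (f : ℕ → Sphere → Sphere) (A : SphereProd) : Prop :=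
  ∀ k, f k (A k) = ((0 : ℂ) : Sphere) ∧
    0 < (sphereDeriv (f k) (A k)).re ∧ (sphereDeriv (f k) (A k)).im = 0

/-- Partially conformal maps of the unit polydisc, with constant `δ`: `F(Z) = (f_k(z_k))_k` where
each `f_k` is univalent in the unit disc and `δ < |f_k'(0)| < 1 / δ`. As the values lie in the
sphere, the derivative is taken in the standard coordinate at `f_k(0)`. -/
def IsPartiallyConformal (δ : ℝ) (F : SphereProd → SphereProd) : Prop :=
  ∃ f : ℕ → Sphere → Sphere,
    (∀ Z ∈ unitPolydisc, F Z = coordMap f Z) ∧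
    ∀ k, UnivalentOn (f k) unitDisc ∧
      δ < ‖sphereDeriv (f k) ((0 : ℂ) : Sphere)‖ ∧
      ‖sphereDeriv (f k) ((0 : ℂ) : Sphere)‖ < 1 / δ

end Polycylindrical

open Polycylindrical

/-!
Each factor is treated separately: every `B_k` is mapped conformally onto the unit disc by a Riemann
map `f_k`, and the rest of the theorem is a statement about these maps.

The Riemann mapping theorem is needed for a domain `B` of the sphere with connected boundary. The
complement of such a domain is connected (`isPreconnected_compl_of_frontier`), and after a Möbius
transformation which takes a boundary point to `∞` the domain becomes a plane domain `U` whose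
complement in the sphere is connected. The heart of the matter is that every holomorphic function
in such a `U` has a primitive (`isExactOn_of_isPreconnected_compl`). Integrating `f` against the
Cauchy kernel and `∂̄χ`, for a cutoff function `χ`, represents `f` on a compact set as a superposition
of kernels `1 / (ζ - z)` with poles `ζ` off that set (`integral_dbar_mul_div_sub`). The primitive of
one such kernel is a branch of a logarithm; the branch is obvious for a pole near `∞`, and it is
continued along the connected complement to all other poles
(`isExactOn_inv_sub_of_isPreconnected`). An integral of these primitives is a primitive of `f`
(`isExactOn_of_isExactOn_inv_sub`), and an exhaustion of `U` finishes the argument. Consequently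
nonvanishing holomorphic functions have square roots, and the Riemann map is the solution of the
usual extremal problem: the extremal function exists by the theorems of Montel and Hurwitz
(`exists_isDiscMap_isMax`), and it is onto by Koebe's square root transformation
(`exists_isDiscMap_deriv_lt`).

If `f` is the Riemann map of `B` with `f a = 0`, then `-log |f|` is the Green function with pole
`a`: any competitor `h` gives on the disc the function `h ∘ f⁻¹ + log |w|`, harmonic also at `0` and
nonnegative by the minimum principle (`IsRiemannMap.greenFunction_eq`). Hence the inner radius is
`1 / |f'(a)|`, the modulus of the derivative of `f⁻¹` at `0` (`IsRiemannMap.innerRadius_eq`), and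
the bounds on the inner radii are exactly the condition that the inverse map is partially conformal.
A coordinatewise map of products is holomorphic as soon as its components are
(`holomorphicMapOn_coordMap`). Uniqueness reduces to a single coordinate, where it is the Schwarz
lemma (`IsRiemannMap.eq_of_normalized`).
-/

open Polycylindrical
open Topology Filter MeasureTheory

namespace Polycylindrical

/-! ### The Cauchy-Riemann operator and a Cauchy formula with a cutoff function -/

/-- The Cauchy-Riemann operator `∂_x + i ∂_y` (twice the Wirtinger derivative `∂̄`). -/
noncomputable def dbar (ψ : ℂ → ℂ) (ζ : ℂ) : ℂ :=
  fderiv ℝ ψ ζ 1 + Complex.I * fderiv ℝ ψ ζ Complex.I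

theorem dbar_eq_zero_of_notMem_tsupport {χ : ℂ → ℂ} {ζ : ℂ} (h : ζ ∉ tsupport χ) :
    dbar χ ζ = 0 := by
  have : fderiv ℝ χ ζ = 0 := by
    by_contra h'
    exact h (support_fderiv_subset ℝ h')
  simp [dbar, this]

theorem continuous_dbar {χ : ℂ → ℂ} (h : ContDiff ℝ 1 χ) : Continuous (dbar χ) := by
  have := h.continuous_fderiv one_ne_zero
  unfold dbar
  fun_prop

theorem dbar_mul {χ g : ℂ → ℂ} {ζ : ℂ} (hχ : DifferentiableAt ℝ χ ζ)
    (hg : DifferentiableAt ℂ g ζ) :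
    dbar (fun z => χ z * g z) ζ = dbar χ ζ * g ζ := by
  have h1 := hχ.hasFDerivAt.mul (hg.hasDerivAt.hasFDerivAt.restrictScalars ℝ)
  have h2 : fderiv ℝ (fun z => χ z * g z) ζ = _ := h1.fderiv
  simp only [dbar, h2]
  simp
  linear_combination (χ ζ * deriv g ζ) * Complex.I_mul_I

theorem dbar_sub {χ ρ : ℂ → ℂ} {ζ : ℂ} (hχ : DifferentiableAt ℝ χ ζ)
    (hρ : DifferentiableAt ℝ ρ ζ) :
    dbar (fun z => χ z - ρ z) ζ = dbar χ ζ - dbar ρ ζ := by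
  have h2 : fderiv ℝ (fun z => χ z - ρ z) ζ = _ := (hχ.hasFDerivAt.sub hρ.hasFDerivAt).fderiv
  simp only [dbar, h2]
  simp
  ring

theorem dbar_eq_zero_of_eventually_eq_const {χ : ℂ → ℂ} {c ζ : ℂ} (h : ∀ᶠ w in 𝓝 ζ, χ w = c) :
    dbar χ ζ = 0 := by
  have : fderiv ℝ χ ζ = 0 := by
    have : χ =ᶠ[𝓝 ζ] fun _ => c := h
    rw [this.fderiv_eq]; simp
  simp [dbar, this]

theorem integral_dbar_eq_zero {ψ : ℂ → ℂ} (h : ContDiff ℝ 1 ψ) (hc : HasCompactSupport ψ) :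
    ∫ ζ, dbar ψ ζ = 0 := by
  have hf := h.continuous_fderiv one_ne_zero
  have hint : ∀ v : ℂ, Integrable (fun ζ => fderiv ℝ ψ ζ v) := fun v =>
    (hf.clm_apply continuous_const).integrable_of_hasCompactSupport (hc.fderiv_apply ℝ v)
  have key : ∀ v : ℂ, ∫ ζ, fderiv ℝ ψ ζ v = 0 := fun v => by
    have := integral_mul_fderiv_eq_neg_fderiv_mul_of_integrable (μ := (volume : Measure ℂ))
      (f := fun _ : ℂ => (1 : ℂ)) (g := ψ) (v := v) (by simp) (by simpa using hint v)
      (by simpa using h.continuous.integrable_of_hasCompactSupport hc)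
      (fun _ _ => differentiableAt_const _)
      (fun x _ => (h.differentiable one_ne_zero) x)
    simpa using this
  unfold dbar
  rw [integral_add (hint 1) ((hint Complex.I).const_mul _), integral_const_mul, key, key]
  simp

/-- A product of a function with a continuous function defined near its support. -/
theorem continuous_mul_of_continuousOn {X : Type*} [TopologicalSpace X] {a b : X → ℂ} {V : Set X}
    (ha : Continuous a) (hV : IsOpen V) (hb : ContinuousOn b V) (hav : tsupport a ⊆ V) :
    Continuous (fun x => a x * b x) := by
  rw [continuous_iff_continuousAt]
  intro x
  by_cases hx : x ∈ V
  · exact ha.continuousAt.mul (hb.continuousAt (hV.mem_nhds hx))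
  · have : (fun x => a x * b x) =ᶠ[𝓝 x] fun _ => 0 := by
      have := (isClosed_tsupport a).isOpen_compl.mem_nhds (fun h => hx (hav h))
      filter_upwards [this] with y hy
      rw [image_eq_zero_of_notMem_tsupport hy, zero_mul]
    exact continuousAt_const.congr this.symm

theorem integral_dbar_mul_eq_zero {χ g : ℂ → ℂ} {V : Set ℂ} (h : ContDiff ℝ 1 χ)
    (hc : HasCompactSupport χ) (hV : IsOpen V) (hχV : tsupport χ ⊆ V)
    (hg : DifferentiableOn ℂ g V) : ∫ ζ, dbar χ ζ * g ζ = 0 := by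
  have e : ∀ ζ, dbar (fun z => χ z * g z) ζ = dbar χ ζ * g ζ := by
    intro ζ
    by_cases hζ : ζ ∈ V
    · exact dbar_mul ((h.differentiable one_ne_zero) ζ) (hg.differentiableAt (hV.mem_nhds hζ))
    · have h0 : ζ ∉ tsupport χ := fun h => hζ (hχV h)
      rw [dbar_eq_zero_of_notMem_tsupport h0, zero_mul]
      apply dbar_eq_zero_of_eventually_eq_const (c := 0)
      filter_upwards [(isClosed_tsupport χ).isOpen_compl.mem_nhds h0] with y hy
      rw [image_eq_zero_of_notMem_tsupport hy, zero_mul]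
  simp_rw [← e]
  apply integral_dbar_eq_zero
  · rw [contDiff_iff_contDiffAt]
    intro ζ
    by_cases hζ : ζ ∈ V
    · have : AnalyticAt ℂ g ζ := hg.analyticAt (hV.mem_nhds hζ)
      exact h.contDiffAt.mul (this.restrictScalars (𝕜 := ℝ)).contDiffAt
    · have h0 : ζ ∉ tsupport χ := fun h => hζ (hχV h)
      have : (fun z => χ z * g z) =ᶠ[𝓝 ζ] fun _ => 0 := by
        filter_upwards [(isClosed_tsupport χ).isOpen_compl.mem_nhds h0] with y hy
        rw [image_eq_zero_of_notMem_tsupport hy, zero_mul]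
      exact contDiffAt_const.congr_of_eventuallyEq this
  · exact hc.mul_right

theorem tsupport_dbar_subset (χ : ℂ → ℂ) : tsupport (dbar χ) ⊆ tsupport χ := by
  apply closure_minimal _ (isClosed_tsupport χ)
  intro x hx
  by_contra h
  exact hx (dbar_eq_zero_of_notMem_tsupport h)

theorem notMem_tsupport_dbar {χ : ℂ → ℂ} {c z : ℂ} (h : ∀ᶠ w in 𝓝 z, χ w = c) :
    z ∉ tsupport (dbar χ) := by
  rw [notMem_tsupport_iff_eventuallyEq]
  filter_upwards [h.eventually_nhds] with w hw
  exact dbar_eq_zero_of_eventually_eq_const hw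

theorem continuous_dbar_mul {χ k : ℂ → ℂ} {V : Set ℂ} (h : ContDiff ℝ 1 χ) (hV : IsOpen V)
    (hk : ContinuousOn k V) (hsub : tsupport (dbar χ) ⊆ V) :
    Continuous (fun ζ => dbar χ ζ * k ζ) :=
  continuous_mul_of_continuousOn (continuous_dbar h) hV hk hsub

theorem integrable_dbar_mul {χ k : ℂ → ℂ} {V : Set ℂ} (h : ContDiff ℝ 1 χ)
    (hc : HasCompactSupport χ) (hV : IsOpen V) (hk : ContinuousOn k V)
    (hsub : tsupport (dbar χ) ⊆ V) :
    Integrable (fun ζ => dbar χ ζ * k ζ) := by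
  have h1 : HasCompactSupport (dbar χ) :=
    hc.of_isClosed_subset (isClosed_tsupport _) (tsupport_dbar_subset χ)
  exact (continuous_dbar_mul h hV hk hsub).integrable_of_hasCompactSupport h1.mul_right

/-- A radial cutoff function: `1` near `0` and `0` outside a disc. -/
noncomputable def radialBump (ζ : ℂ) : ℂ := ((Real.smoothTransition (2 - Complex.normSq ζ) : ℝ) : ℂ)

theorem contDiff_radialBump : ContDiff ℝ 1 radialBump := by
  have h1 : ContDiff ℝ 1 (fun ζ : ℂ => Complex.normSq ζ) := by
    have : (fun ζ : ℂ => Complex.normSq ζ) = fun ζ => ‖ζ‖ ^ 2 := by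
      ext ζ; rw [Complex.normSq_eq_norm_sq]
    rw [this]
    exact contDiff_norm_sq ℝ
  exact Complex.ofRealCLM.contDiff.comp
    (Real.smoothTransition.contDiff.comp (contDiff_const.sub h1))

theorem radialBump_eq_zero {ζ : ℂ} (h : 2 ≤ ‖ζ‖) : radialBump ζ = 0 := by
  unfold radialBump
  rw [Real.smoothTransition.zero_of_nonpos]; · simp
  rw [Complex.normSq_eq_norm_sq]; nlinarith

theorem hasCompactSupport_radialBump : HasCompactSupport radialBump := by
  apply HasCompactSupport.intro (isCompact_closedBall (0 : ℂ) 2)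
  intro x hx
  apply radialBump_eq_zero
  simp at hx; exact hx.le

theorem eventually_radialBump_eq_one : ∀ᶠ ζ in 𝓝 (0 : ℂ), radialBump ζ = 1 := by
  filter_upwards [Metric.ball_mem_nhds (0 : ℂ) one_pos] with ζ hζ
  unfold radialBump
  rw [Real.smoothTransition.one_of_one_le]; · simp
  rw [Complex.normSq_eq_norm_sq]
  simp at hζ
  nlinarith [norm_nonneg ζ]

theorem dbar_radialBump (ζ : ℂ) :
    dbar radialBump ζ = ((-2 * deriv Real.smoothTransition (2 - Complex.normSq ζ) : ℝ) : ℂ) * ζ := by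
  have h1 : HasFDerivAt (fun ζ : ℂ => Complex.normSq ζ)
      ((2 * ζ.re) • Complex.reCLM + (2 * ζ.im) • Complex.imCLM) ζ := by
    have h3 := ((Complex.reCLM.hasFDerivAt (x := ζ)).mul (Complex.reCLM.hasFDerivAt (x := ζ))).add
      ((Complex.imCLM.hasFDerivAt (x := ζ)).mul (Complex.imCLM.hasFDerivAt (x := ζ)))
    refine HasFDerivAt.congr_fderiv h3 ?_
    ext v
    simp
    ring
  have h2 : HasDerivAt Real.smoothTransition _ (2 - Complex.normSq ζ) :=
    ((Real.smoothTransition.contDiff (n := 1)).differentiable one_ne_zero _).hasDerivAt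
  have h4 := Complex.ofRealCLM.hasFDerivAt.comp ζ (h2.comp_hasFDerivAt ζ (h1.const_sub 2))
  have h5 : fderiv ℝ radialBump ζ = _ := HasFDerivAt.fderiv h4
  simp only [dbar, h5]
  apply Complex.ext
  · simp; ring
  · simp; ring

theorem deriv_smoothTransition_nonneg (t : ℝ) : 0 ≤ deriv Real.smoothTransition t :=
  Monotone.deriv_nonneg Real.smoothTransition.monotone

/-- The constant in the Cauchy formula with a cutoff; its exact value `-2π` is not needed. -/
noncomputable def cauchyConst : ℂ :=
  ∫ ζ : ℂ, ((-2 * deriv Real.smoothTransition (2 - Complex.normSq ζ) : ℝ) : ℂ)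

theorem cauchyConst_ne_zero : cauchyConst ≠ 0 := by
  have hcont : Continuous (deriv Real.smoothTransition) :=
    (Real.smoothTransition.contDiff (n := 1)).continuous_deriv le_rfl
  have hn : Continuous (fun ζ : ℂ => Complex.normSq ζ) := Complex.continuous_normSq
  have hpos : 0 < ∫ ζ : ℂ, deriv Real.smoothTransition (2 - Complex.normSq ζ) := by
    have hzero : ∀ t < 0, deriv Real.smoothTransition t = 0 := by
      intro t ht
      have : Real.smoothTransition =ᶠ[𝓝 t] fun _ => 0 := by
        filter_upwards [gt_mem_nhds ht] with s hs
        exact Real.smoothTransition.zero_of_nonpos hs.le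
      rw [this.deriv_eq]; simp
    obtain ⟨c, hc, hd⟩ := exists_deriv_eq_slope Real.smoothTransition (zero_lt_one' ℝ)
      Real.smoothTransition.continuous.continuousOn
      ((Real.smoothTransition.contDiff (n := 1)).differentiable one_ne_zero).differentiableOn
    apply Continuous.integral_pos_of_hasCompactSupport_nonneg_nonzero (x := (Real.sqrt (2 - c) : ℂ))
    · exact hcont.comp (continuous_const.sub hn)
    · apply HasCompactSupport.intro (isCompact_closedBall (0 : ℂ) 2)
      intro x hx
      apply hzero
      simp at hx
      rw [Complex.normSq_eq_norm_sq]; nlinarith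
    · intro ζ; exact deriv_smoothTransition_nonneg _
    · have : Complex.normSq (Real.sqrt (2 - c) : ℂ) = 2 - c := by
        rw [Complex.normSq_ofReal, Real.mul_self_sqrt]; linarith [hc.2]
      rw [this, sub_sub_cancel, hd]
      simp
  unfold cauchyConst
  rw [integral_complex_ofReal, integral_const_mul]
  exact_mod_cast mul_ne_zero (by norm_num : (-2 : ℝ) ≠ 0) hpos.ne'

/-- Cauchy's integral formula in the form `∬ ∂̄χ(ζ) f(ζ) / (ζ - z) = c f(z)`, for a cutoff function
`χ` which is `1` near `z`. -/
theorem integral_dbar_mul_div_sub {χ f : ℂ → ℂ} {U : Set ℂ} {z : ℂ} (h : ContDiff ℝ 1 χ)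
    (hc : HasCompactSupport χ) (hU : IsOpen U) (hχU : tsupport χ ⊆ U)
    (hf : DifferentiableOn ℂ f U) (hz : ∀ᶠ w in 𝓝 z, χ w = 1) :
    ∫ ζ, dbar χ ζ * (f ζ / (ζ - z)) = cauchyConst * f z := by
  have hzM : z ∉ tsupport (dbar χ) := notMem_tsupport_dbar hz
  have hzU : z ∈ U := hχU (subset_tsupport χ (by simp [hz.self_of_nhds]))
  have hV : IsOpen (U \ {z}) := hU.sdiff isClosed_singleton
  have hsub : tsupport (dbar χ) ⊆ U \ {z} := fun ζ hζ =>
    ⟨hχU (tsupport_dbar_subset χ hζ), fun e => hzM (e ▸ hζ)⟩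
  have hinv : ContinuousOn (fun ζ : ℂ => (ζ - z)⁻¹) (U \ {z}) := by
    apply ContinuousOn.inv₀ (by fun_prop)
    intro ζ hζ; exact sub_ne_zero.2 hζ.2
  have hfc : ContinuousOn f (U \ {z}) := hf.continuousOn.mono Set.sdiff_subset
  -- The difference quotient of `f` is holomorphic, so its integral vanishes.
  have e1 : ∫ ζ, dbar χ ζ * (f ζ / (ζ - z)) - f z * (dbar χ ζ * (ζ - z)⁻¹) = 0 := by
    rw [← integral_dbar_mul_eq_zero h hc hU hχU
      ((Complex.differentiableOn_dslope (hU.mem_nhds hzU)).2 hf)]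
    congr 1; ext ζ
    by_cases hζ : ζ = z
    · subst hζ
      rw [image_eq_zero_of_notMem_tsupport hzM]; simp
    · rw [dslope_of_ne _ hζ, slope_def_field]
      ring
  have i1 : Integrable (fun ζ => dbar χ ζ * (f ζ / (ζ - z))) :=
    integrable_dbar_mul h hc hV (by simp only [div_eq_mul_inv]; exact hfc.mul hinv) hsub
  have i2 : Integrable (fun ζ => dbar χ ζ * (ζ - z)⁻¹) := integrable_dbar_mul h hc hV hinv hsub
  rw [integral_sub i1 (i2.const_mul _), integral_const_mul, sub_eq_zero] at e1
  rw [e1, mul_comm]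
  congr 1
  -- The constant does not depend on the cutoff function; compare with the radial one.
  let ρ : ℂ → ℂ := fun ζ => radialBump (ζ - z)
  have hρ : ContDiff ℝ 1 ρ := contDiff_radialBump.comp (contDiff_id.sub contDiff_const)
  have hρc : HasCompactSupport ρ :=
    hasCompactSupport_radialBump.comp_homeomorph (Homeomorph.subRight z)
  have hρ1 : ∀ᶠ w in 𝓝 z, ρ w = 1 := by
    have : Tendsto (fun w => w - z) (𝓝 z) (𝓝 0) := by
      have : Continuous fun w : ℂ => w - z := by fun_prop
      simpa using this.tendsto z
    exact this.eventually eventually_radialBump_eq_one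
  have hdρ : ∀ ζ, dbar ρ ζ = dbar radialBump (ζ - z) := fun ζ => by
    simp only [dbar, ρ, fderiv_comp_sub]
  have hW : IsOpen ({z}ᶜ : Set ℂ) := isOpen_compl_singleton
  have hinv' : DifferentiableOn ℂ (fun ζ : ℂ => (ζ - z)⁻¹) {z}ᶜ := by
    apply DifferentiableOn.inv (by fun_prop)
    intro ζ hζ; exact sub_ne_zero.2 hζ
  have e2 : ∫ ζ, dbar (fun w => χ w - ρ w) ζ * (ζ - z)⁻¹ = 0 := by
    refine integral_dbar_mul_eq_zero (h.sub hρ) (hc.sub hρc) hW ?_ hinv'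
    rintro ζ hζ rfl
    refine (notMem_tsupport_iff_eventuallyEq.2 ?_) hζ
    filter_upwards [hz, hρ1] with w h1 h2
    simp [h1, h2]
  have i3 : Integrable (fun ζ => dbar ρ ζ * (ζ - z)⁻¹) := by
    refine integrable_dbar_mul hρ hρc hW hinv'.continuousOn ?_
    rintro ζ hζ rfl
    exact notMem_tsupport_dbar hρ1 hζ
  have e3 : ∫ ζ, dbar χ ζ * (ζ - z)⁻¹ - dbar ρ ζ * (ζ - z)⁻¹ = 0 := by
    rw [← e2]
    congr 1; ext ζ
    rw [dbar_sub (h.differentiable one_ne_zero ζ) (hρ.differentiable one_ne_zero ζ)]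
    ring
  rw [integral_sub i2 i3, sub_eq_zero] at e3
  rw [e3]
  have e4 : ∫ ζ : ℂ, dbar ρ ζ * (ζ - z)⁻¹ = ∫ ζ : ℂ, dbar radialBump ζ * ζ⁻¹ := by
    simp_rw [hdρ]
    exact integral_sub_right_eq_self (fun ζ => dbar radialBump ζ * ζ⁻¹) z
  rw [e4]
  unfold cauchyConst
  apply integral_congr_ae
  filter_upwards [compl_mem_ae_iff.2 (measure_singleton (0 : ℂ))] with ζ hζ
  rw [dbar_radialBump, mul_assoc, mul_inv_cancel₀ hζ, mul_one]

/-! ### Primitives in domains with connected complement -/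

open Complex (IsExactOn)

/-- Since `(q - z) / (p - z)` stays in the disc of radius `1` about `1`, it has a logarithm, whose
derivative is the difference of the two Cauchy kernels. -/
theorem isExactOn_inv_sub_of_near {W : Set ℂ} {p q : ℂ} (h : ∀ z ∈ W, ‖p - q‖ < ‖p - z‖)
    (hp : IsExactOn (fun z => (p - z)⁻¹) W) : IsExactOn (fun z => (q - z)⁻¹) W := by
  obtain ⟨g, hg⟩ := hp
  refine ⟨fun z => g z - Complex.log ((q - z) / (p - z)), fun z hz => ?_⟩
  have hpz : p - z ≠ 0 := norm_pos_iff.1 ((norm_nonneg _).trans_lt (h z hz))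
  have hqz : q - z ≠ 0 := by
    intro e
    have := h z hz
    rw [sub_eq_zero.1 e] at this
    exact lt_irrefl _ this
  have hs : (q - z) / (p - z) ∈ Complex.slitPlane := by
    rw [← add_sub_cancel (1 : ℂ) ((q - z) / (p - z))]
    apply Complex.mem_slitPlane_of_norm_lt_one
    rw [div_sub_one hpz, norm_div, div_lt_one (norm_pos_iff.2 hpz)]
    have := h z hz
    rw [norm_sub_rev] at this
    simpa using this
  have h1 : HasDerivAt (fun z => (q - z) / (p - z)) _ z :=
    ((hasDerivAt_id z).const_sub q).div ((hasDerivAt_id z).const_sub p) hpz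
  refine ((hg z hz).sub (h1.clog hs)).congr_deriv ?_
  simp only [id]
  field_simp
  ring

theorem isExactOn_inv_sub_of_far {W : Set ℂ} {q : ℂ} (h : ∀ z ∈ W, ‖z‖ < ‖q‖) :
    IsExactOn (fun z => (q - z)⁻¹) W := by
  refine ⟨fun z => - Complex.log (1 - z / q), fun z hz => ?_⟩
  have hq : q ≠ 0 := norm_pos_iff.1 ((norm_nonneg _).trans_lt (h z hz))
  have hqz : q - z ≠ 0 := by
    intro e
    have := h z hz
    rw [sub_eq_zero.1 e] at this
    exact lt_irrefl _ this
  have hs : 1 - z / q ∈ Complex.slitPlane := by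
    rw [sub_eq_add_neg]
    apply Complex.mem_slitPlane_of_norm_lt_one
    rw [norm_neg, norm_div, div_lt_one (norm_pos_iff.2 hq)]
    exact h z hz
  have h1 : HasDerivAt (fun z => 1 - z / q) _ z := ((hasDerivAt_id z).div_const q).const_sub 1
  refine (h1.clog hs).neg.congr_deriv ?_
  have : 1 - z / q ≠ 0 := Complex.slitPlane_ne_zero hs
  have e : q - z = q * (1 - z / q) := by field_simp
  simp only [e]
  field_simp

/-- If `K` is a connected subset of the sphere which contains `∞` and keeps away from the bounded
set `W`, then the logarithm of `p - z` has a branch in `W` for `p = ∞` (formally) and hence, by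
continuation along `K`, for every finite `p ∈ K`. -/
theorem isExactOn_inv_sub_of_isPreconnected {W : Set ℂ} {K : Set Sphere} (hK : IsPreconnected K)
    (hinf : OnePoint.infty ∈ K) {ε R : ℝ} (hε : 0 < ε) (hR : ∀ z ∈ W, ‖z‖ ≤ R)
    (hW : ∀ p : ℂ, (p : Sphere) ∈ K → ∀ z ∈ W, ε ≤ ‖p - z‖) {p : ℂ} (hp : (p : Sphere) ∈ K) :
    IsExactOn (fun z => (p - z)⁻¹) W := by
  let E : Sphere → Prop := fun s => ∀ a : ℂ, s = (a : Sphere) → IsExactOn (fun z => (a - z)⁻¹) W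
  have hE : ∀ a : ℂ, E a ↔ IsExactOn (fun z => (a - z)⁻¹) W := fun a =>
    ⟨fun h => h a rfl, fun h b hb => by rwa [← OnePoint.coe_injective hb]⟩
  have hEinf : E OnePoint.infty := fun a ha => absurd ha (OnePoint.infty_ne_coe a)
  have key : E OnePoint.infty ↔ E p := by
    refine hK.induction₂ (fun x y => E x ↔ E y) ?_ (fun _ _ _ _ _ _ h1 h2 => h1.trans h2)
      (fun _ _ _ _ h => h.symm) hinf hp
    intro x hx
    induction x using OnePoint.rec with
    | infty =>
      have h1 : ∀ᶠ y : Sphere in 𝓝 OnePoint.infty, E y := by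
        rw [OnePoint.nhds_infty_eq]
        refine mem_sup.2 ⟨?_, by simpa using hEinf⟩
        refine mem_map.2 (Filter.hasBasis_coclosedCompact.mem_iff.2 ⟨Metric.closedBall 0 R,
          ⟨Metric.isClosed_closedBall, isCompact_closedBall _ _⟩, ?_⟩)
        intro q hq
        refine (hE q).2 (isExactOn_inv_sub_of_far fun z hz => (hR z hz).trans_lt ?_)
        simpa using hq
      filter_upwards [nhdsWithin_le_nhds h1] with y hy
      simp [hy, hEinf]
    | coe a =>
      have h1 : ∀ᶠ y : Sphere in 𝓝 (a : Sphere), ∃ b : ℂ, y = b ∧ ‖a - b‖ < ε := by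
        rw [OnePoint.nhds_coe_eq, eventually_map]
        filter_upwards [Metric.ball_mem_nhds a hε] with b hb
        exact ⟨b, rfl, by rwa [← dist_eq_norm, dist_comm]⟩
      filter_upwards [nhdsWithin_le_nhds h1, self_mem_nhdsWithin] with y hy hyK
      obtain ⟨b, rfl, hb⟩ := hy
      rw [hE, hE]
      refine ⟨isExactOn_inv_sub_of_near fun z hz => hb.trans_le (hW a hx z hz),
        isExactOn_inv_sub_of_near fun z hz => ?_⟩
      rw [norm_sub_rev]
      exact hb.trans_le (hW b hyK z hz)
  exact (hE p).1 (key.1 hEinf)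

/-- Integrating the primitives of the Cauchy kernels, a function holomorphic near the compact set
`L` has a primitive in each domain contained in `L`. -/
theorem isExactOn_of_isExactOn_inv_sub {f χ : ℂ → ℂ} {U L W : Set ℂ} (hχ : ContDiff ℝ 1 χ)
    (hc : HasCompactSupport χ) (hU : IsOpen U) (hχU : tsupport χ ⊆ U)
    (hf : DifferentiableOn ℂ f U) (hL : IsCompact L) (hχL : ∀ z ∈ L, ∀ᶠ w in 𝓝 z, χ w = 1)
    (hW : IsOpen W) (hWc : IsPreconnected W) (hWL : W ⊆ L)
    (hex : ∀ ζ ∉ L, IsExactOn (fun z => (ζ - z)⁻¹) W) : IsExactOn f W := by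
  rcases W.eq_empty_or_nonempty with rfl | ⟨z₀, hz₀⟩
  · exact ⟨0, by simp⟩
  have hex' : ∀ ζ, ∃ g : ℂ → ℂ, ζ ∉ L → g z₀ = 0 ∧ ∀ z ∈ W, HasDerivAt g (ζ - z)⁻¹ z := by
    intro ζ
    by_cases h : ζ ∈ L
    · exact ⟨0, fun h' => absurd h h'⟩
    · obtain ⟨g, hg⟩ := (hex ζ h).with_val_at z₀ 0
      exact ⟨g, fun _ => hg⟩
  choose ell hell using hex'
  have hM : tsupport (dbar χ) ⊆ Lᶜ := fun ζ hζ hL' => notMem_tsupport_dbar (hχL ζ hL') hζ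
  have hLo : IsOpen Lᶜ := hL.isClosed.isOpen_compl
  have hne : ∀ ζ ∉ L, ∀ z ∈ W, ζ - z ≠ 0 := fun ζ hζ z hz e =>
    hζ (by rw [sub_eq_zero.1 e]; exact hWL hz)
  -- The normalized primitives depend continuously on the pole.
  have hcont : ∀ z ∈ W, ContinuousOn (fun ζ => ell ζ z) Lᶜ := by
    intro z hz ζ₀ hζ₀
    apply ContinuousAt.continuousWithinAt
    have hd : 0 < Metric.infDist ζ₀ L :=
      (hL.isClosed.notMem_iff_infDist_pos ⟨z₀, hWL hz₀⟩).1 hζ₀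
    have hev : ∀ᶠ ζ in 𝓝 ζ₀, ell ζ z =
        ell ζ₀ z - Complex.log ((ζ - z) / (ζ₀ - z)) + Complex.log ((ζ - z₀) / (ζ₀ - z₀)) := by
      filter_upwards [Metric.ball_mem_nhds ζ₀ hd, hLo.mem_nhds hζ₀] with ζ hζ hζL
      have hslit : ∀ w ∈ W, (ζ - w) / (ζ₀ - w) ∈ Complex.slitPlane := by
        intro w hw
        have h0 := hne ζ₀ hζ₀ w hw
        have : 1 + ((ζ - w) / (ζ₀ - w) - 1) ∈ Complex.slitPlane := by
          apply Complex.mem_slitPlane_of_norm_lt_one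
          rw [div_sub_one h0, norm_div, div_lt_one (norm_pos_iff.2 h0)]
          have h1 : dist ζ ζ₀ < Metric.infDist ζ₀ L := hζ
          have h2 := Metric.infDist_le_dist_of_mem (x := ζ₀) (hWL hw)
          rw [dist_eq_norm] at h1 h2
          simpa using h1.trans_le h2
        simpa using this
      have hder : ∀ w ∈ W, HasDerivAt (fun w => ell ζ₀ w - Complex.log ((ζ - w) / (ζ₀ - w)))
          (ζ - w)⁻¹ w := by
        intro w hw
        have h0 := hne ζ₀ hζ₀ w hw
        have h0' := hne ζ hζL w hw
        have h1 : HasDerivAt (fun w => (ζ - w) / (ζ₀ - w)) _ w :=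
          ((hasDerivAt_id w).const_sub ζ).div ((hasDerivAt_id w).const_sub ζ₀) h0
        refine (((hell ζ₀ hζ₀).2 w hw).sub (h1.clog (hslit w hw))).congr_deriv ?_
        simp only [id]
        field_simp
        ring
      have hder2 : ∀ w ∈ W, HasDerivAt
          (fun w => ell ζ w - Complex.log ((ζ - z₀) / (ζ₀ - z₀))) (ζ - w)⁻¹ w := fun w hw =>
        ((hell ζ hζL).2 w hw).sub_const _
      have := hW.eqOn_of_deriv_eq hWc
        (fun w hw => (hder2 w hw).differentiableAt.differentiableWithinAt)
        (fun w hw => (hder w hw).differentiableAt.differentiableWithinAt)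
        (fun w hw => by rw [(hder2 w hw).deriv, (hder w hw).deriv]) hz₀
        (by simp [(hell ζ hζL).1, (hell ζ₀ hζ₀).1]) hz
      simp only at this
      linear_combination this
    have hcl : ∀ w ∈ W, ContinuousAt (fun ζ => Complex.log ((ζ - w) / (ζ₀ - w))) ζ₀ := by
      intro w hw
      apply ContinuousAt.clog (by fun_prop)
      rw [div_self (hne ζ₀ hζ₀ w hw)]
      exact Complex.one_mem_slitPlane
    refine ContinuousAt.congr ?_ (hev.mono fun _ h => h.symm)
    exact (continuousAt_const.sub (hcl z hz)).add (hcl z₀ hz₀)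
  have hfL : ContinuousOn f (U ∩ Lᶜ) := hf.continuousOn.mono Set.inter_subset_left
  have hUL : IsOpen (U ∩ Lᶜ) := hU.inter hLo
  have hMUL : tsupport (dbar χ) ⊆ U ∩ Lᶜ := fun ζ hζ => ⟨hχU (tsupport_dbar_subset χ hζ), hM hζ⟩
  have hker : ∀ z ∈ W, ContinuousOn (fun ζ => f ζ * (ζ - z)⁻¹) (U ∩ Lᶜ) := fun z hz =>
    hfL.mul (ContinuousOn.inv₀ (by fun_prop) fun ζ hζ => hne ζ hζ.2 z hz)
  have hprim : ∀ z ∈ W, Integrable (fun ζ => dbar χ ζ * (f ζ * ell ζ z)) := fun z hz =>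
    integrable_dbar_mul hχ hc hUL (hfL.mul ((hcont z hz).mono Set.inter_subset_right)) hMUL
  refine ⟨fun z => cauchyConst⁻¹ * ∫ ζ, dbar χ ζ * (f ζ * ell ζ z), fun z hz => ?_⟩
  obtain ⟨r, hr, hrW⟩ := Metric.isOpen_iff.1 hW z hz
  have hbd : Integrable (fun ζ => ‖dbar χ ζ * f ζ‖ * (r / 2)⁻¹) :=
    (integrable_dbar_mul hχ hc hUL hfL hMUL).norm.mul_const _
  have hball : Metric.ball z (r / 2) ⊆ W := (Metric.ball_subset_ball (by linarith)).trans hrW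
  have main := (hasDerivAt_integral_of_dominated_loc_of_deriv_le (μ := (volume : Measure ℂ))
    (F := fun w ζ => dbar χ ζ * (f ζ * ell ζ w))
    (F' := fun w ζ => dbar χ ζ * (f ζ * (ζ - w)⁻¹))
    (Metric.ball_mem_nhds z (half_pos hr))
    (by filter_upwards [hW.mem_nhds hz] with w hw using (hprim w hw).aestronglyMeasurable)
    (hprim z hz)
    (integrable_dbar_mul hχ hc hUL (hker z hz) hMUL).aestronglyMeasurable
    (ae_of_all _ fun ζ w hw => ?_) hbd (ae_of_all _ fun ζ w hw => ?_)).2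
  · refine (main.const_mul cauchyConst⁻¹).congr_deriv ?_
    have e := integral_dbar_mul_div_sub hχ hc hU hχU hf (hχL z (hWL hz))
    simp only [div_eq_mul_inv] at e
    rw [e, inv_mul_cancel_left₀ cauchyConst_ne_zero]
  · by_cases hζ : ζ ∈ tsupport (dbar χ)
    · have h1 : r / 2 ≤ ‖ζ - w‖ := by
        by_contra hlt
        push Not at hlt
        apply hM hζ
        apply hWL
        apply hrW
        have h2 : dist w z < r / 2 := hw
        have h3 := dist_triangle ζ w z
        rw [dist_eq_norm ζ w] at h3
        simp only [Metric.mem_ball]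
        linarith
      rw [← mul_assoc, norm_mul, norm_inv]
      gcongr
    · rw [image_eq_zero_of_notMem_tsupport hζ]; simp
  · by_cases hζ : ζ ∈ tsupport (dbar χ)
    · exact (((hell ζ (hM hζ)).2 w (hball hw)).const_mul (f ζ)).const_mul (dbar χ ζ)
    · rw [image_eq_zero_of_notMem_tsupport hζ]
      simpa using hasDerivAt_const w (0 : ℂ)

theorem exists_contDiff_cutoff {L U : Set ℂ} (hL : IsCompact L) (hU : IsOpen U) (hLU : L ⊆ U) :
    ∃ χ : ℂ → ℂ, ContDiff ℝ 1 χ ∧ HasCompactSupport χ ∧ tsupport χ ⊆ U ∧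
      ∀ z ∈ L, ∀ᶠ w in 𝓝 z, χ w = 1 := by
  obtain ⟨K, hK, hLK, hKU⟩ := exists_compact_between hL hU hLU
  obtain ⟨g, h1, h0, -⟩ := exists_contMDiffMap_one_nhds_of_subset_interior (n := 1)
    (modelWithCornersSelf ℝ ℂ) hL.isClosed hLK
  have hts : tsupport (fun z => ((g z : ℝ) : ℂ)) ⊆ K := by
    apply closure_minimal _ hK.isClosed
    intro z hz
    by_contra hzK
    exact hz (by simp [h0 z hzK])
  refine ⟨fun z => ((g z : ℝ) : ℂ), ?_, hK.of_isClosed_subset (isClosed_tsupport _) hts,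
    hts.trans hKU, fun z hz => ?_⟩
  · exact Complex.ofRealCLM.contDiff.comp g.contMDiff.contDiff
  · filter_upwards [eventually_nhdsSet_iff_forall.1 h1 z hz] with w hw
    simp [hw]

/-- Primitives can be glued along an increasing sequence of domains. -/
theorem isExactOn_iUnion {f : ℂ → ℂ} {W : ℕ → Set ℂ} {z₀ : ℂ} (hW : ∀ n, IsOpen (W n))
    (hc : ∀ n, IsPreconnected (W n)) (hz₀ : ∀ n, z₀ ∈ W n) (hmono : Monotone W)
    (hex : ∀ n, IsExactOn f (W n)) : IsExactOn f (⋃ n, W n) := by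
  classical
  choose g hg0 hg using fun n => (hex n).with_val_at z₀ (0 : ℂ)
  have hag : ∀ m n, m ≤ n → Set.EqOn (g m) (g n) (W m) := fun m n hmn =>
    (hW m).eqOn_of_deriv_eq (hc m)
      (fun w hw => (hg m w hw).differentiableAt.differentiableWithinAt)
      (fun w hw => (hg n w (hmono hmn hw)).differentiableAt.differentiableWithinAt)
      (fun w hw => by rw [(hg m w hw).deriv, (hg n w (hmono hmn hw)).deriv]) (hz₀ m)
      (by rw [hg0, hg0])
  let G : ℂ → ℂ := fun z => if h : ∃ n, z ∈ W n then g (Nat.find h) z else 0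
  have hG : ∀ n, Set.EqOn G (g n) (W n) := by
    intro n z hz
    have h : ∃ n, z ∈ W n := ⟨n, hz⟩
    simp only [G, dif_pos h]
    exact hag _ n (Nat.find_min' h hz) (Nat.find_spec h)
  refine ⟨G, fun z hz => ?_⟩
  obtain ⟨n, hn⟩ := Set.mem_iUnion.1 hz
  exact (hg n z hn).congr_of_eventuallyEq
    (by filter_upwards [(hW n).mem_nhds hn] with w hw using hG n hw)

/-- Cauchy's theorem for a plane domain whose complement in the sphere is connected: every
holomorphic function has a primitive. -/
theorem isExactOn_of_isPreconnected_compl {f : ℂ → ℂ} {U : Set ℂ} (hU : IsOpen U)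
    (hUc : IsConnected U) (hK : IsPreconnected ((((↑) : ℂ → Sphere) '' U)ᶜ)) (hne : U ≠ Set.univ)
    (hf : DifferentiableOn ℂ f U) : IsExactOn f U := by
  obtain ⟨z₀, hz₀⟩ := hUc.nonempty
  have hCne : (Uᶜ).Nonempty := Set.nonempty_compl.2 hne
  have hCcl : IsClosed Uᶜ := hU.isClosed_compl
  have hpos : ∀ z ∈ U, 0 < Metric.infDist z Uᶜ := fun z hz =>
    (hCcl.notMem_iff_infDist_pos hCne).1 (fun h => h hz)
  -- An exhaustion of `U` by bounded open sets at positive distance from the complement.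
  let O : ℕ → Set ℂ := fun n => {z | ‖z‖ < n ∧ 1 / ((n : ℝ) + 1) < Metric.infDist z Uᶜ}
  have hO : ∀ n, IsOpen (O n) := fun n =>
    (isOpen_lt continuous_norm continuous_const).inter
      (isOpen_lt continuous_const (Metric.continuous_infDist_pt _))
  have hOmono : Monotone O := by
    intro m n hmn z hz
    have : (m : ℝ) ≤ n := by exact_mod_cast hmn
    exact ⟨hz.1.trans_le this, lt_of_le_of_lt (by gcongr) hz.2⟩
  have hOU : ∀ z ∈ U, ∃ n, z ∈ O n := by
    intro z hz
    obtain ⟨n1, h1⟩ := exists_nat_gt ‖z‖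
    obtain ⟨n2, h2⟩ := exists_nat_one_div_lt (hpos z hz)
    refine ⟨max n1 n2, ?_, ?_⟩
    · exact h1.trans_le (by exact_mod_cast le_max_left _ _)
    · refine lt_of_le_of_lt ?_ h2
      have : (n2 : ℝ) ≤ (max n1 n2 : ℕ) := by exact_mod_cast le_max_right _ _
      gcongr
  obtain ⟨N, hN⟩ := hOU z₀ hz₀
  let W : ℕ → Set ℂ := fun n => connectedComponentIn (O (N + n)) z₀
  have hz₀O : ∀ n, z₀ ∈ O (N + n) := fun n => hOmono (Nat.le_add_right N n) hN
  have hWU : U ⊆ ⋃ n, W n := by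
    intro z hz
    obtain ⟨γ, hγ⟩ := (hU.isConnected_iff_isPathConnected.1 hUc).joinedIn z₀ hz₀ z hz
    obtain ⟨n, hn⟩ := (isCompact_range γ.continuous).elim_directed_cover (fun n => O (N + n))
      (fun n => hO _)
      (by
        rintro _ ⟨t, rfl⟩
        obtain ⟨n, hn⟩ := hOU _ (hγ t)
        exact Set.mem_iUnion.2 ⟨n, hOmono (Nat.le_add_left n N) hn⟩)
      (fun m n => ⟨max m n, hOmono (by lia), hOmono (by lia)⟩)
    refine Set.mem_iUnion.2 ⟨n, ?_⟩
    exact (isPreconnected_range γ.continuous).subset_connectedComponentIn ⟨0, γ.source⟩ hn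
      ⟨1, γ.target⟩
  suffices h : IsExactOn f (⋃ n, W n) by
    obtain ⟨g, hg⟩ := h
    exact ⟨g, fun z hz => hg z (hWU hz)⟩
  refine isExactOn_iUnion (z₀ := z₀) (fun n => (hO _).connectedComponentIn)
    (fun n => isPreconnected_connectedComponentIn) (fun n => mem_connectedComponentIn (hz₀O n))
    (fun m n hmn => connectedComponentIn_mono _ (hOmono (by lia))) (fun n => ?_)
  set k : ℕ := N + n
  set ε : ℝ := 1 / ((k : ℝ) + 1) with hεdef
  have hε : 0 < ε := by positivity
  let L : Set ℂ := {z | ‖z‖ ≤ k ∧ ε ≤ Metric.infDist z Uᶜ}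
  have hLcl : IsClosed L := (isClosed_le continuous_norm continuous_const).inter
    (isClosed_le continuous_const (Metric.continuous_infDist_pt _))
  have hLc : IsCompact L := by
    refine (isCompact_closedBall (0 : ℂ) k).of_isClosed_subset hLcl fun z hz => ?_
    simpa using hz.1
  have hLU : L ⊆ U := by
    intro z hz
    by_contra h
    have := hz.2
    rw [Metric.infDist_zero_of_mem (show z ∈ Uᶜ from h)] at this
    linarith
  have hWO : W n ⊆ O k := connectedComponentIn_subset _ _
  have hOL : O k ⊆ L := fun z hz => ⟨hz.1.le, hz.2.le⟩
  obtain ⟨χ, h1, h2, h3, h4⟩ := exists_contDiff_cutoff hLc hU hLU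
  refine isExactOn_of_isExactOn_inv_sub h1 h2 hU h3 hf hLc h4 (hO _).connectedComponentIn
    isPreconnected_connectedComponentIn (hWO.trans hOL) fun ζ hζ => ?_
  have hinf : OnePoint.infty ∈ (((↑) : ℂ → Sphere) '' U)ᶜ := by
    rintro ⟨w, -, hw⟩
    exact OnePoint.coe_ne_infty w hw
  by_cases hζk : ‖ζ‖ ≤ k
  · -- The pole is close to a point of the complement.
    have h5 : Metric.infDist ζ Uᶜ < ε := by
      by_contra h
      exact hζ ⟨hζk, not_lt.1 h⟩
    obtain ⟨p, hp, hpd⟩ := (Metric.infDist_lt_iff hCne).1 h5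
    have hpK : (p : Sphere) ∈ (((↑) : ℂ → Sphere) '' U)ᶜ := by
      rintro ⟨w, hw, e⟩
      exact hp (OnePoint.coe_injective e ▸ hw)
    have hdist : ∀ p : ℂ, (p : Sphere) ∈ (((↑) : ℂ → Sphere) '' U)ᶜ → ∀ z ∈ W n,
        ε ≤ ‖p - z‖ := by
      intro q hq z hz
      have h6 := Metric.infDist_le_dist_of_mem (x := z)
        (show q ∈ Uᶜ from fun h => hq ⟨q, h, rfl⟩)
      rw [dist_comm, dist_eq_norm] at h6
      exact ((hWO hz).2.le).trans h6
    refine isExactOn_inv_sub_of_near (p := p) (fun z hz => ?_)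
      (isExactOn_inv_sub_of_isPreconnected hK hinf hε (R := k) (fun z hz => (hWO hz).1.le) hdist
        hpK)
    rw [← dist_eq_norm, dist_comm]
    exact hpd.trans_le (hdist p hpK z hz)
  · exact isExactOn_inv_sub_of_far fun z hz => (hWO hz).1.trans (not_le.1 hζk)

/-! ### Univalent functions in plane domains -/

theorem not_eventually_eq_of_injOn {f : ℂ → ℂ} {U : Set ℂ} (hU : IsOpen U)
    (hinj : Set.InjOn f U) {z : ℂ} (hz : z ∈ U) : ¬ ∀ᶠ w in 𝓝 z, f w = f z := by
  intro h
  have h1 : ∀ᶠ w in 𝓝[≠] z, w = z := by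
    filter_upwards [nhdsWithin_le_nhds h, nhdsWithin_le_nhds (hU.mem_nhds hz)] with w h2 h3
      using hinj h3 hz h2
  have h2 : ∀ᶠ w in 𝓝[≠] z, False := by
    filter_upwards [h1, self_mem_nhdsWithin] with w h3 h4 using h4 h3
  exact (NeBot.ne inferInstance) (eventually_false_iff_eq_bot.1 h2)

theorem nhds_le_map_of_injOn {f : ℂ → ℂ} {U : Set ℂ} (hU : IsOpen U)
    (hf : DifferentiableOn ℂ f U) (hinj : Set.InjOn f U) {z : ℂ} (hz : z ∈ U) :
    𝓝 (f z) ≤ map f (𝓝 z) :=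
  ((hf.analyticAt (hU.mem_nhds hz)).eventually_constant_or_nhds_le_map_nhds).resolve_left
    (not_eventually_eq_of_injOn hU hinj hz)

theorem isOpen_image_of_injOn {f : ℂ → ℂ} {U : Set ℂ} (hU : IsOpen U)
    (hf : DifferentiableOn ℂ f U) (hinj : Set.InjOn f U) : IsOpen (f '' U) := by
  rw [isOpen_iff_mem_nhds]
  rintro _ ⟨z, hz, rfl⟩
  exact nhds_le_map_of_injOn hU hf hinj hz (image_mem_map (hU.mem_nhds hz))

/-- The inverse of a univalent function is holomorphic: it is continuous by the open mapping
theorem, so that the isolated critical values are removable singularities. -/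
theorem differentiableAt_of_leftInvOn {f g : ℂ → ℂ} {U : Set ℂ} (hU : IsOpen U)
    (hf : DifferentiableOn ℂ f U) (hinj : Set.InjOn f U) (hg : Set.LeftInvOn g f U) {z : ℂ}
    (hz : z ∈ U) : DifferentiableAt ℂ g (f z) := by
  have hcont : ∀ w ∈ U, ContinuousAt g (f w) := by
    intro w hw
    have h1 : map g (𝓝 (f w)) ≤ map g (map f (𝓝 w)) := map_mono (nhds_le_map_of_injOn hU hf hinj hw)
    have h2 : map g (map f (𝓝 w)) = 𝓝 w := by
      rw [map_map]
      conv_rhs => rw [← map_id (f := 𝓝 w)]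
      apply Filter.map_congr
      filter_upwards [hU.mem_nhds hw] with x hx using hg hx
    rw [ContinuousAt, hg hw, Tendsto]
    exact h1.trans h2.le
  have hVo := isOpen_image_of_injOn hU hf hinj
  have hright : ∀ y ∈ f '' U, f (g y) = y := by
    rintro _ ⟨x, hx, rfl⟩
    rw [hg hx]
  have hana := hf.analyticAt (hU.mem_nhds hz)
  have hne : ∀ᶠ w in 𝓝[≠] z, deriv f w ≠ 0 := by
    refine hana.deriv.eventually_eq_zero_or_eventually_ne_zero.resolve_left fun h0 => ?_
    apply not_eventually_eq_of_injOn hU hinj hz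
    obtain ⟨r, hr, hball⟩ := Metric.eventually_nhds_iff_ball.1 (h0.and (hU.mem_nhds hz))
    filter_upwards [Metric.ball_mem_nhds z hr] with w hw
    refine Metric.isOpen_ball.eqOn_of_deriv_eq (𝕜 := ℂ) (g := fun _ => f z)
      (convex_ball z r).isPreconnected
      (hf.mono fun x hx => (hball x hx).2) (differentiableOn_const _)
      (fun x hx => by simpa using (hball x hx).1) (Metric.mem_ball_self hr) rfl hw
  refine (Complex.analyticAt_of_differentiable_on_punctured_nhds_of_continuousAt ?_
    (hcont z hz)).differentiableAt
  have h1 : Tendsto g (𝓝[≠] (f z)) (𝓝[≠] z) := by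
    apply tendsto_nhdsWithin_of_tendsto_nhds_of_eventually_within
    · have := (hcont z hz).tendsto
      rw [hg hz] at this
      exact this.mono_left nhdsWithin_le_nhds
    · filter_upwards [self_mem_nhdsWithin, nhdsWithin_le_nhds (hVo.mem_nhds ⟨z, hz, rfl⟩)]
        with y hy hyV e
      exact hy (by rw [← hright y hyV, e]; rfl)
  filter_upwards [h1.eventually hne, nhdsWithin_le_nhds (hVo.mem_nhds ⟨z, hz, rfl⟩)] with y h2 hyV
  obtain ⟨x, hx, rfl⟩ := hyV
  rw [hg hx] at h2
  have hd := (hf.differentiableAt (hU.mem_nhds hx)).hasDerivAt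
  refine (HasDerivAt.of_local_left_inverse (f := f) (hcont x hx) (by rwa [hg hx]) h2 ?_).differentiableAt
  filter_upwards [hVo.mem_nhds ⟨x, hx, rfl⟩] with y hy using hright y hy

theorem deriv_ne_zero_of_injOn {f : ℂ → ℂ} {U : Set ℂ} (hU : IsOpen U)
    (hf : DifferentiableOn ℂ f U) (hinj : Set.InjOn f U) {z : ℂ} (hz : z ∈ U) :
    deriv f z ≠ 0 := by
  have hl : Set.LeftInvOn (Function.invFunOn f U) f U := hinj.leftInvOn_invFunOn
  have h1 := (differentiableAt_of_leftInvOn hU hf hinj hl hz).hasDerivAt.comp z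
    (hf.differentiableAt (hU.mem_nhds hz)).hasDerivAt
  have h2 : HasDerivAt (Function.invFunOn f U ∘ f) 1 z := by
    refine (hasDerivAt_id z).congr_of_eventuallyEq ?_
    filter_upwards [hU.mem_nhds hz] with w hw using hl hw
  intro h0
  have := h1.unique h2
  rw [h0, mul_zero] at this
  exact zero_ne_one this

/-- Hurwitz's theorem: a locally uniform limit of univalent functions is univalent, unless it is
constant. -/
theorem injOn_of_tendstoLocallyUniformlyOn {ι : Type*} {l : Filter ι} [l.NeBot] {F : ι → ℂ → ℂ}
    {g : ℂ → ℂ} {U : Set ℂ} {z₀ : ℂ} (hU : IsOpen U) (hUc : IsPreconnected U)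
    (hF : ∀ n, DifferentiableOn ℂ (F n) U) (hinj : ∀ n, Set.InjOn (F n) U)
    (hlim : TendstoLocallyUniformlyOn F g l U) (hz₀ : z₀ ∈ U) (hg₀ : deriv g z₀ ≠ 0) :
    Set.InjOn g U := by
  intro a ha b hb hab
  by_contra hne
  have hg : DifferentiableOn ℂ g U := hlim.differentiableOn (Eventually.of_forall hF) hU
  have hga : AnalyticOnNhd ℂ g U := hg.analyticOnNhd hU
  have hiso : ∀ᶠ w in 𝓝[≠] a, g w ≠ g a := by
    refine ((hga a ha).eventually_eq_or_eventually_ne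
      (analyticAt_const (v := g a))).resolve_left fun h => hg₀ ?_
    have := hga.eqOn_of_preconnected_of_eventuallyEq (g := fun _ => g a)
      (fun _ _ => analyticAt_const) hUc ha h
    have h2 : g =ᶠ[𝓝 z₀] fun _ => g a := by
      filter_upwards [hU.mem_nhds hz₀] with w hw using this hw
    rw [h2.deriv_eq]; simp
  obtain ⟨r, hr, hball⟩ : ∃ r > 0, ∀ w ∈ Metric.closedBall a r, w ∈ U ∧ w ≠ b ∧
      (w ≠ a → g w ≠ g a) := by
    have : ∀ᶠ w in 𝓝 a, w ∈ U ∧ w ≠ b ∧ (w ≠ a → g w ≠ g a) :=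
      (hU.eventually_mem ha).and
        ((isOpen_ne.eventually_mem hne).and (eventually_nhdsWithin_iff.1 hiso))
    exact Metric.nhds_basis_closedBall.eventually_iff.1 this
  have hcU : Metric.closedBall a r ⊆ U := fun w hw => (hball w hw).1
  have hsc : Metric.sphere a r ⊆ Metric.closedBall a r := Metric.sphere_subset_closedBall
  obtain ⟨w₀, hw₀, hmin⟩ := (isCompact_sphere a r).exists_isMinOn
    (NormedSpace.sphere_nonempty.2 hr.le) (f := fun w => ‖g w - g a‖)
    (((hg.continuousOn.mono (hsc.trans hcU)).sub continuousOn_const).norm)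
  set m := ‖g w₀ - g a‖
  have hm : 0 < m := norm_pos_iff.2 (sub_ne_zero.2 ((hball w₀ (hsc hw₀)).2.2
    (Metric.ne_of_mem_sphere hw₀ hr.ne')))
  have hunif := (tendstoLocallyUniformlyOn_iff_forall_isCompact hU).1 hlim _ hcU
    (isCompact_closedBall a r)
  have hb' := hlim.tendsto_at hb
  have ha' : a ∈ Metric.closedBall a r := Metric.mem_closedBall_self hr.le
  obtain ⟨n, hn1, hn2⟩ := ((Metric.tendstoUniformlyOn_iff.1 hunif (m / 8) (by positivity)).and
    (hb'.eventually (Metric.ball_mem_nhds (g b) (show 0 < m / 8 by positivity)))).exists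
  have hn3 := hn1 a ha'
  have hsphere : ∀ z ∈ Metric.sphere a r, m / 2 ≤ ‖F n z - F n a‖ := by
    intro z hz
    have h1 := hn1 z (hsc hz)
    have h2 : m ≤ ‖g z - g a‖ := hmin hz
    rw [← dist_eq_norm] at h2 ⊢
    have h4 := dist_triangle4 (g z) (F n z) (F n a) (g a)
    rw [dist_comm (F n a)] at h4
    linarith
  have hdc : DiffContOnCl ℂ (F n) (Metric.ball a r) :=
    ((hF n).mono ((closure_minimal Metric.ball_subset_closedBall
      Metric.isClosed_closedBall).trans hcU)).diffContOnCl
  have hfr : ∃ᶠ z in 𝓝 a, F n z ≠ F n a := by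
    have := not_eventually_eq_of_injOn hU (hinj n) ha
    rwa [not_eventually] at this
  have hmem : F n b ∈ Metric.ball (F n a) (m / 2 / 2) := by
    have h1 : dist (F n b) (g b) < m / 8 := hn2
    have h2 := dist_triangle (F n b) (g b) (F n a)
    rw [hab.symm] at h1 h2
    simp only [Metric.mem_ball]
    linarith
  obtain ⟨c, hc, hcb⟩ := hdc.ball_subset_image_closedBall hr hsphere hfr hmem
  exact (hball c hc).2.1 (hinj n (hcU hc) hb hcb)

/-- Montel's theorem, for functions with values in the unit disc and limits along ultrafilters. -/
theorem exists_tendstoLocallyUniformlyOn {ι : Type*} (l : Ultrafilter ι) {F : ι → ℂ → ℂ}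
    {U : Set ℂ} (hU : IsOpen U) (hF : ∀ n, DifferentiableOn ℂ (F n) U)
    (hb : ∀ n, Set.MapsTo (F n) U (Metric.ball 0 1)) :
    ∃ g : ℂ → ℂ, TendstoLocallyUniformlyOn F g l U ∧ Set.MapsTo g U (Metric.closedBall 0 1) := by
  have hpt : ∀ z, ∃ w : ℂ, z ∈ U → w ∈ Metric.closedBall (0 : ℂ) 1 ∧
      Tendsto (fun n => F n z) l (𝓝 w) := by
    intro z
    by_cases hz : z ∈ U
    · obtain ⟨w, hw, h⟩ := (isCompact_closedBall (0 : ℂ) 1).ultrafilter_le_nhds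
        (l.map fun n => F n z) (by
          rw [le_principal_iff, Ultrafilter.mem_coe, Ultrafilter.mem_map]
          exact univ_mem' fun n => Metric.ball_subset_closedBall (hb n hz))
      exact ⟨w, fun _ => ⟨hw, h⟩⟩
    · exact ⟨0, fun h => absurd h hz⟩
  choose g hg using hpt
  refine ⟨g, ?_, fun z hz => (hg z hz).1⟩
  rw [Metric.tendstoLocallyUniformlyOn_iff]
  intro ε hε x hx
  obtain ⟨r, hr, hrU⟩ := Metric.isOpen_iff.1 hU x hx
  -- The functions are uniformly Lipschitz near `x` by the Schwarz lemma.
  have hlip : ∀ n, ∀ y ∈ Metric.ball x r, dist (F n y) (F n x) ≤ 2 / r * dist y x := by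
    intro n y hy
    refine Complex.dist_le_div_mul_dist_of_mapsTo_ball ((hF n).mono hrU) (fun w hw => ?_) hy
    have h1 : dist (F n w) 0 < 1 := hb n (hrU hw)
    have h2 : dist (F n x) 0 < 1 := hb n hx
    have := dist_triangle_right (F n w) (F n x) 0
    simp only [Metric.mem_closedBall]
    linarith
  set δ := min r (ε * r / 8)
  have hδ : 0 < δ := by positivity
  have hsmall : ∀ n, ∀ y ∈ Metric.ball x δ, dist (F n y) (F n x) ≤ ε / 4 := by
    intro n y hy
    have hy' : dist y x < δ := hy
    refine (hlip n y (hy'.trans_le (min_le_left _ _))).trans ?_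
    have : dist y x ≤ ε * r / 8 := (hy'.trans_le (min_le_right _ _)).le
    calc 2 / r * dist y x ≤ 2 / r * (ε * r / 8) := by gcongr
      _ = ε / 4 := by field_simp; norm_num
  refine ⟨Metric.ball x δ, nhdsWithin_le_nhds (Metric.ball_mem_nhds x hδ), ?_⟩
  filter_upwards [(hg x hx).2.eventually (Metric.ball_mem_nhds (g x) (show 0 < ε / 4 by positivity))]
    with n hn y hy
  have hyU : y ∈ U := hrU (Metric.ball_subset_ball (min_le_left _ _) hy)
  have h1 : dist (g y) (g x) ≤ ε / 4 :=
    le_of_tendsto ((hg y hyU).2.dist (hg x hx).2) (Eventually.of_forall fun n => hsmall n y hy)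
  have h2 : dist (F n x) (g x) < ε / 4 := hn
  have h3 := hsmall n y hy
  have h4 := dist_triangle4 (g y) (g x) (F n x) (F n y)
  rw [dist_comm (g x), dist_comm (F n x) (F n y)] at h4
  linarith

/-! ### The Riemann mapping theorem in the plane -/

/-- If every holomorphic function in `U` has a primitive, a nonvanishing `g` has the square root
`exp (P / 2)`, where `P` is a suitable primitive of `g' / g`. -/
theorem exists_sq_eq_of_isExactOn {g : ℂ → ℂ} {U : Set ℂ} (hU : IsOpen U) (hUc : IsConnected U)
    (hex : ∀ f : ℂ → ℂ, DifferentiableOn ℂ f U → IsExactOn f U) (hg : DifferentiableOn ℂ g U)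
    (hg0 : ∀ z ∈ U, g z ≠ 0) : ∃ h : ℂ → ℂ, DifferentiableOn ℂ h U ∧ ∀ z ∈ U, h z ^ 2 = g z := by
  obtain ⟨z₀, hz₀⟩ := hUc.nonempty
  obtain ⟨P, hP0, hP⟩ := (hex (fun z => deriv g z / g z)
    ((hg.deriv hU).div hg hg0)).with_val_at z₀ (Complex.log (g z₀))
  have hE : ∀ z ∈ U, HasDerivAt (fun z => g z * Complex.exp (-P z)) 0 z := by
    intro z hz
    refine ((hg.differentiableAt (hU.mem_nhds hz)).hasDerivAt.mul
      ((hP z hz).neg.cexp)).congr_deriv ?_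
    have := hg0 z hz
    simp only [Pi.neg_apply]
    field_simp
    ring
  have hone := hU.eqOn_of_deriv_eq (𝕜 := ℂ) (g := fun _ => (1 : ℂ)) hUc.isPreconnected
    (fun z hz => (hE z hz).differentiableAt.differentiableWithinAt) (differentiableOn_const _)
    (fun z hz => by rw [(hE z hz).deriv]; simp) hz₀
    (by simp [hP0, Complex.exp_neg, Complex.exp_log (hg0 z₀ hz₀), hg0 z₀ hz₀])
  refine ⟨fun z => Complex.exp (P z / 2), fun z hz =>
    ((hP z hz).div_const 2).cexp.differentiableAt.differentiableWithinAt, fun z hz => ?_⟩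
  have h1 : g z * Complex.exp (-P z) = 1 := hone hz
  rw [← Complex.exp_nat_mul]
  rw [Complex.exp_neg] at h1
  have h2 := Complex.exp_ne_zero (P z)
  field_simp at h1
  rw [h1]
  congr 1
  push_cast
  ring

/-- The Möbius automorphism of the unit disc which takes `a` to `0`. -/
noncomputable def discAut (a z : ℂ) : ℂ := (z - a) / (1 - (starRingEnd ℂ) a * z)

theorem one_sub_conj_mul_ne_zero {a z : ℂ} (ha : ‖a‖ < 1) (hz : ‖z‖ < 1) :
    1 - (starRingEnd ℂ) a * z ≠ 0 := by
  intro h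
  have h1 : ‖(starRingEnd ℂ) a * z‖ = 1 := by rw [← sub_eq_zero.1 h, norm_one]
  rw [norm_mul, RCLike.norm_conj] at h1
  nlinarith [norm_nonneg a, norm_nonneg z]

theorem norm_discAut_lt_one {a z : ℂ} (ha : ‖a‖ < 1) (hz : ‖z‖ < 1) : ‖discAut a z‖ < 1 := by
  have h0 := one_sub_conj_mul_ne_zero ha hz
  rw [discAut, norm_div, div_lt_one (norm_pos_iff.2 h0)]
  refine lt_of_pow_lt_pow_left₀ 2 (norm_nonneg _) ?_
  have ha' : ‖a‖ ^ 2 < 1 := by nlinarith [norm_nonneg a]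
  have hz' : ‖z‖ ^ 2 < 1 := by nlinarith [norm_nonneg z]
  rw [← Complex.normSq_eq_norm_sq, Complex.normSq_apply] at *
  rw [← Complex.normSq_eq_norm_sq, Complex.normSq_apply]
  simp
  nlinarith

theorem hasDerivAt_discAut {a z : ℂ} (ha : ‖a‖ < 1) (hz : ‖z‖ < 1) :
    HasDerivAt (discAut a) ((1 - a * (starRingEnd ℂ) a) / (1 - (starRingEnd ℂ) a * z) ^ 2) z := by
  have h0 := one_sub_conj_mul_ne_zero ha hz
  refine (((hasDerivAt_id z).sub_const a).div
    (((hasDerivAt_id z).const_mul ((starRingEnd ℂ) a)).const_sub 1) h0).congr_deriv ?_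
  simp only [id]
  congr 1
  ring

theorem injOn_discAut {a : ℂ} (ha : ‖a‖ < 1) : Set.InjOn (discAut a) (Metric.ball 0 1) := by
  intro z hz w hw h
  have hz' : ‖z‖ < 1 := by simpa using hz
  have hw' : ‖w‖ < 1 := by simpa using hw
  have h1 := one_sub_conj_mul_ne_zero ha hz'
  have h2 := one_sub_conj_mul_ne_zero ha hw'
  have h3 := one_sub_conj_mul_ne_zero ha ha
  rw [discAut, discAut, div_eq_div_iff h1 h2] at h
  have : (1 - (starRingEnd ℂ) a * a) * (z - w) = 0 := by linear_combination h
  exact sub_eq_zero.1 ((mul_eq_zero.1 this).resolve_left h3)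

/-- Univalent maps of `U` into the unit disc which take `z₀` to `0`: the competitors in the extremal
problem `|f'(z₀)| → max` that characterizes the Riemann map. -/
structure IsDiscMap (U : Set ℂ) (z₀ : ℂ) (f : ℂ → ℂ) : Prop where
  diff : DifferentiableOn ℂ f U
  inj : Set.InjOn f U
  maps : Set.MapsTo f U (Metric.ball 0 1)
  zero : f z₀ = 0

theorem isDiscMap_discAut_comp {U : Set ℂ} {z₀ : ℂ} {f : ℂ → ℂ} (hf : DifferentiableOn ℂ f U)
    (hinj : Set.InjOn f U) (hmaps : Set.MapsTo f U (Metric.ball 0 1)) (hz₀ : z₀ ∈ U) :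
    IsDiscMap U z₀ (fun z => discAut (f z₀) (f z)) := by
  have hn : ∀ z ∈ U, ‖f z‖ < 1 := fun z hz => by simpa using hmaps hz
  refine ⟨?_, ?_, ?_, ?_⟩
  · intro z hz
    exact (hasDerivAt_discAut (hn z₀ hz₀) (hn z hz)).differentiableAt.comp_differentiableWithinAt z
      (hf z hz)
  · exact (injOn_discAut (hn z₀ hz₀)).comp hinj hmaps
  · intro z hz
    simpa using norm_discAut_lt_one (hn z₀ hz₀) (hn z hz)
  · simp [discAut]

/-- A branch `h` of the square root of `z - p`, with `p` outside `U`, is univalent and never takes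
opposite values; its image therefore omits a disc, and an inversion in that disc maps it into the
unit disc. -/
theorem exists_isDiscMap {U : Set ℂ} (hU : IsOpen U) (hne : U ≠ Set.univ)
    (hsq : ∀ g : ℂ → ℂ, DifferentiableOn ℂ g U → (∀ z ∈ U, g z ≠ 0) →
      ∃ h : ℂ → ℂ, DifferentiableOn ℂ h U ∧ ∀ z ∈ U, h z ^ 2 = g z) {z₀ : ℂ} (hz₀ : z₀ ∈ U) :
    ∃ f, IsDiscMap U z₀ f := by
  obtain ⟨p, hp⟩ := (Set.ne_univ_iff_exists_notMem U).1 hne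
  obtain ⟨h, hd, hh⟩ := hsq (fun z => z - p) (by fun_prop)
    (fun z hz => sub_ne_zero.2 fun e => hp (e ▸ hz))
  have hinj : Set.InjOn h U := by
    intro z hz w hw e
    have h1 := hh z hz
    rw [e, hh w hw] at h1
    exact (sub_left_injective h1).symm
  -- The image of `h` contains a disc about `h z₀` and therefore omits the opposite disc.
  have hopen := isOpen_image_of_injOn hU hd hinj
  obtain ⟨ε, hε, hball⟩ := Metric.isOpen_iff.1 hopen (h z₀) ⟨z₀, hz₀, rfl⟩
  have hfar : ∀ z ∈ U, ε ≤ ‖h z + h z₀‖ := by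
    intro z hz
    by_contra hlt
    push Not at hlt
    obtain ⟨w, hw, hwe⟩ := hball (show -h z ∈ Metric.ball (h z₀) ε by
      rw [mem_ball_iff_norm, ← norm_neg]
      simpa [add_comm] using hlt)
    have h1 : w = z := by
      have := hh w hw
      rw [hwe, neg_sq, hh z hz] at this
      exact (sub_left_injective this).symm
    subst h1
    have h2 : h w = 0 := by linear_combination hwe / 2
    have h3 := hh w hw
    rw [h2] at h3
    exact hp (by rw [show p = w by linear_combination h3]; exact hw)
  have hne0 : ∀ z ∈ U, h z + h z₀ ≠ 0 := fun z hz => norm_pos_iff.1 (hε.trans_le (hfar z hz))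
  have hεc : ((ε / 2 : ℝ) : ℂ) ≠ 0 := by exact_mod_cast (half_pos hε).ne'
  refine ⟨_, isDiscMap_discAut_comp (f := fun z => ((ε / 2 : ℝ) : ℂ) / (h z + h z₀)) ?_ ?_ ?_ hz₀⟩
  · exact (differentiableOn_const _).div (hd.add_const _) hne0
  · intro z hz w hw e
    simp only at e
    rw [div_eq_div_iff (hne0 z hz) (hne0 w hw)] at e
    exact hinj hz hw (add_right_cancel (mul_left_cancel₀ hεc e)).symm
  · intro z hz
    rw [mem_ball_zero_iff, norm_div, Complex.norm_real, Real.norm_of_nonneg (half_pos hε).le,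
      div_lt_one (hε.trans_le (hfar z hz))]
    linarith [hfar z hz]

/-- The extremal problem has a solution: a limit of a maximizing sequence is not constant since its
derivative at `z₀` does not vanish, and so it is univalent by Hurwitz's theorem. -/
theorem exists_isDiscMap_isMax {U : Set ℂ} (hU : IsOpen U) (hUc : IsPreconnected U) {z₀ : ℂ}
    (hz₀ : z₀ ∈ U) (hex : ∃ f, IsDiscMap U z₀ f) :
    ∃ f, IsDiscMap U z₀ f ∧ ∀ g, IsDiscMap U z₀ g → ‖deriv g z₀‖ ≤ ‖deriv f z₀‖ := by
  let S : Set ℝ := {x | ∃ f, IsDiscMap U z₀ f ∧ x = ‖deriv f z₀‖}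
  obtain ⟨f₀, hf₀⟩ := hex
  have hSne : S.Nonempty := ⟨_, f₀, hf₀, rfl⟩
  obtain ⟨r, hr, hrU⟩ := Metric.isOpen_iff.1 hU z₀ hz₀
  have hSb : BddAbove S := by
    refine ⟨1 / r, ?_⟩
    rintro _ ⟨f, hf, rfl⟩
    refine Complex.norm_deriv_le_div_of_mapsTo_ball (hf.diff.mono hrU) (fun w hw => ?_) hr
    rw [hf.zero]
    exact Metric.ball_subset_closedBall (hf.maps (hrU hw))
  obtain ⟨u, -, hu, huS⟩ := exists_seq_tendsto_sSup hSne hSb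
  choose F hF hFu using huS
  obtain ⟨f, hlim, hcl⟩ := exists_tendstoLocallyUniformlyOn (Filter.hyperfilter ℕ) hU
    (fun n => (hF n).diff) (fun n => (hF n).maps)
  have hle : (Filter.hyperfilter ℕ : Filter ℕ) ≤ atTop := by
    rw [← Nat.cofinite_eq_atTop]; exact Filter.hyperfilter_le_cofinite
  have hdiff : DifferentiableOn ℂ f U :=
    hlim.differentiableOn (Eventually.of_forall fun n => (hF n).diff) hU
  have hderiv : ‖deriv f z₀‖ = sSup S := by
    have h1 := ((hlim.deriv (Eventually.of_forall fun n => (hF n).diff) hU).tendsto_at hz₀).norm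
    have h2 : Tendsto u (Filter.hyperfilter ℕ) (𝓝 (sSup S)) := hu.mono_left hle
    refine tendsto_nhds_unique h1 (h2.congr fun n => ?_)
    rw [hFu n]; rfl
  have hmax : ∀ g, IsDiscMap U z₀ g → ‖deriv g z₀‖ ≤ ‖deriv f z₀‖ := fun g hg => by
    rw [hderiv]; exact le_csSup hSb ⟨g, hg, rfl⟩
  have hne : deriv f z₀ ≠ 0 := by
    refine norm_pos_iff.1 (lt_of_lt_of_le ?_ (hmax f₀ hf₀))
    exact norm_pos_iff.2 (deriv_ne_zero_of_injOn hU hf₀.diff hf₀.inj hz₀)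
  have hinj : Set.InjOn f U := injOn_of_tendstoLocallyUniformlyOn hU hUc (fun n => (hF n).diff)
    (fun n => (hF n).inj) hlim hz₀ hne
  refine ⟨f, ⟨hdiff, hinj, ?_, ?_⟩, hmax⟩
  · have h1 : f '' U ⊆ interior (Metric.closedBall 0 1) :=
      interior_maximal (Set.image_subset_iff.2 hcl) (isOpen_image_of_injOn hU hdiff hinj)
    rw [interior_closedBall _ one_ne_zero] at h1
    exact Set.image_subset_iff.1 h1
  · refine tendsto_nhds_unique (hlim.tendsto_at hz₀) ?_
    simp [(hF _).zero]

/-- Koebe's square root transformation: a competitor which omits a value of the disc is not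
extremal. -/
theorem exists_isDiscMap_deriv_lt {U : Set ℂ} (hU : IsOpen U)
    (hsq : ∀ g : ℂ → ℂ, DifferentiableOn ℂ g U → (∀ z ∈ U, g z ≠ 0) →
      ∃ h : ℂ → ℂ, DifferentiableOn ℂ h U ∧ ∀ z ∈ U, h z ^ 2 = g z) {z₀ : ℂ} (hz₀ : z₀ ∈ U)
    {f : ℂ → ℂ} (hf : IsDiscMap U z₀ f) {w : ℂ} (hw : ‖w‖ < 1) (hwf : w ∉ f '' U) :
    ∃ g, IsDiscMap U z₀ g ∧ ‖deriv f z₀‖ < ‖deriv g z₀‖ := by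
  have hn : ∀ z ∈ U, ‖f z‖ < 1 := fun z hz => by simpa using hf.maps hz
  have hψd : DifferentiableOn ℂ (fun z => discAut w (f z)) U := fun z hz =>
    (hasDerivAt_discAut hw (hn z hz)).differentiableAt.comp_differentiableWithinAt z (hf.diff z hz)
  obtain ⟨h, hd, hh⟩ := hsq _ hψd (fun z hz => by
    refine div_ne_zero (sub_ne_zero.2 ?_) (one_sub_conj_mul_ne_zero hw (hn z hz))
    rintro rfl
    exact hwf ⟨z, hz, rfl⟩)
  have hψi : Set.InjOn (fun z => discAut w (f z)) U := (injOn_discAut hw).comp hf.inj hf.maps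
  have hhi : Set.InjOn h U := by
    intro a ha b hb e
    apply hψi ha hb
    simp only
    rw [← hh a ha, ← hh b hb, e]
  have hhn : ∀ z ∈ U, ‖h z‖ < 1 := by
    intro z hz
    have h1 : ‖h z‖ ^ 2 < 1 := by
      rw [← norm_pow, hh z hz]; exact norm_discAut_lt_one hw (hn z hz)
    nlinarith [norm_nonneg (h z)]
  refine ⟨_, isDiscMap_discAut_comp hd hhi (fun z hz => by simpa using hhn z hz) hz₀, ?_⟩
  have hw0 : w ≠ 0 := by
    rintro rfl
    exact hwf ⟨z₀, hz₀, hf.zero⟩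
  have hfd : HasDerivAt f (deriv f z₀) z₀ :=
    (hf.diff.differentiableAt (hU.mem_nhds hz₀)).hasDerivAt
  have hhd : HasDerivAt h (deriv h z₀) z₀ := (hd.differentiableAt (hU.mem_nhds hz₀)).hasDerivAt
  have hb2 : h z₀ ^ 2 = -w := by rw [hh z₀ hz₀, hf.zero, discAut]; simp
  set b := h z₀ with hb
  set s := ‖b‖ with hs
  have hsw : ‖w‖ = s ^ 2 := by rw [← norm_neg, ← hb2, norm_pow]
  have hs1 : s < 1 := hhn z₀ hz₀
  have hs0 : 0 < s := by
    refine norm_pos_iff.2 fun e => hw0 ?_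
    rw [e] at hb2
    simpa using hb2.symm
  have hconj : ∀ x : ℂ, x * (starRingEnd ℂ) x = ((‖x‖ ^ 2 : ℝ) : ℂ) := fun x => by
    rw [Complex.mul_conj, Complex.normSq_eq_norm_sq]
  -- Differentiate `h ^ 2 = discAut w ∘ f` at `z₀`.
  have e1 : 2 * b * deriv h z₀ = ((1 - s ^ 4 : ℝ) : ℂ) * deriv f z₀ := by
    have h1 : HasDerivAt (fun z => h z ^ 2) _ z₀ := hhd.pow 2
    have h2 : HasDerivAt (fun z => discAut w (f z)) _ z₀ :=
      (hasDerivAt_discAut hw (hn z₀ hz₀)).comp z₀ hfd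
    have h3 : (fun z => h z ^ 2) =ᶠ[𝓝 z₀] fun z => discAut w (f z) := by
      filter_upwards [hU.mem_nhds hz₀] with z hz using hh z hz
    have h4 := h1.unique (h2.congr_of_eventuallyEq h3)
    rw [hconj, hf.zero, hsw] at h4
    simp only [mul_zero, sub_zero, one_pow, div_one] at h4
    push_cast at h4 ⊢
    rw [← hb] at h4
    linear_combination h4
  have e2 : HasDerivAt (fun z => discAut b (h z)) (((1 - s ^ 2)⁻¹ : ℝ) * deriv h z₀) z₀ := by
    have h5 : HasDerivAt (fun z => discAut b (h z)) _ z₀ :=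
      HasDerivAt.comp z₀ (hasDerivAt_discAut (hhn z₀ hz₀) (hhn z₀ hz₀)) hhd
    refine h5.congr_deriv ?_
    rw [mul_comm ((starRingEnd ℂ) _), hconj]
    congr 1
    have : (1 - ((s ^ 2 : ℝ) : ℂ)) ≠ 0 := by
      norm_cast
      nlinarith
    rw [← hb, ← hs]
    push_cast at this ⊢
    field_simp
  rw [e2.deriv, norm_mul, Complex.norm_real]
  have e3 := congrArg norm e1
  rw [norm_mul, norm_mul, norm_mul, Complex.norm_real, ← hs] at e3
  have hp1 : 0 < 1 - s ^ 2 := by nlinarith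
  have hp2 : 0 < 1 - s ^ 4 := by nlinarith [sq_nonneg s]
  rw [Real.norm_of_nonneg (inv_nonneg.2 hp1.le)]
  rw [Real.norm_of_nonneg hp2.le] at e3
  have hdf : 0 < ‖deriv f z₀‖ := norm_pos_iff.2 (deriv_ne_zero_of_injOn hU hf.diff hf.inj hz₀)
  rw [inv_mul_eq_div, lt_div_iff₀ hp1]
  have h2 : (‖(2 : ℂ)‖) = 2 := by simp
  rw [h2] at e3
  have e4 : 2 * s * ‖deriv h z₀‖ = (1 - s ^ 2) * ((1 + s ^ 2) * ‖deriv f z₀‖) := by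
    rw [e3]; ring
  have e5 : 2 * s * ‖deriv f z₀‖ < (1 + s ^ 2) * ‖deriv f z₀‖ := by
    have : 0 < (1 - s) ^ 2 := by
      have : 0 < 1 - s := by linarith
      positivity
    apply mul_lt_mul_of_pos_right _ hdf
    nlinarith
  have e6 : 2 * s * (‖deriv f z₀‖ * (1 - s ^ 2)) < 2 * s * ‖deriv h z₀‖ := by
    rw [e4]
    calc 2 * s * (‖deriv f z₀‖ * (1 - s ^ 2)) = (1 - s ^ 2) * (2 * s * ‖deriv f z₀‖) := by ring
      _ < _ := mul_lt_mul_of_pos_left e5 hp1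
  exact lt_of_mul_lt_mul_left e6 (by positivity)

/-- The Riemann mapping theorem for proper plane domains in which nonvanishing holomorphic functions
have holomorphic square roots. -/
theorem exists_isDiscMap_image_eq {U : Set ℂ} (hU : IsOpen U) (hUc : IsPreconnected U)
    (hne : U ≠ Set.univ)
    (hsq : ∀ g : ℂ → ℂ, DifferentiableOn ℂ g U → (∀ z ∈ U, g z ≠ 0) →
      ∃ h : ℂ → ℂ, DifferentiableOn ℂ h U ∧ ∀ z ∈ U, h z ^ 2 = g z) {z₀ : ℂ} (hz₀ : z₀ ∈ U) :
    ∃ f, IsDiscMap U z₀ f ∧ f '' U = Metric.ball 0 1 := by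
  obtain ⟨f, hf, hmax⟩ := exists_isDiscMap_isMax hU hUc hz₀ (exists_isDiscMap hU hne hsq hz₀)
  refine ⟨f, hf, Set.Subset.antisymm (Set.image_subset_iff.2 hf.maps) fun w hw => ?_⟩
  by_contra hwf
  obtain ⟨g, hg, hlt⟩ := exists_isDiscMap_deriv_lt hU hsq hz₀ hf (by simpa using hw) hwf
  exact absurd (hmax g hg) (not_le.2 hlt)

/-! ### The standard charts of the sphere -/

theorem param_coe (a w : ℂ) : param (a : Sphere) w = ((a + w : ℂ) : Sphere) := rfl

theorem param_infty (w : ℂ) :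
    param OnePoint.infty w = if w = 0 then OnePoint.infty else ((w⁻¹ : ℂ) : Sphere) := rfl

theorem coord_coe_coe (a z : ℂ) : coord (a : Sphere) (z : Sphere) = z - a := rfl

theorem coord_infty_coe (z : ℂ) : coord OnePoint.infty (z : Sphere) = z⁻¹ := rfl

theorem coord_infty_infty : coord OnePoint.infty OnePoint.infty = 0 := rfl

theorem param_zero (p : Sphere) : param p 0 = p := by
  induction p using OnePoint.rec with
  | infty => simp [param_infty]
  | coe a => simp [param_coe]

theorem coord_self (p : Sphere) : coord p p = 0 := by
  induction p using OnePoint.rec with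
  | infty => rfl
  | coe a => simp [coord_coe_coe]

theorem coord_param (p : Sphere) (w : ℂ) : coord p (param p w) = w := by
  induction p using OnePoint.rec with
  | infty =>
    rw [param_infty]
    split_ifs with h
    · rw [coord_infty_infty, h]
    · rw [coord_infty_coe, inv_inv]
  | coe a => rw [param_coe, coord_coe_coe, add_sub_cancel_left]

theorem param_injective (p : Sphere) : Function.Injective (param p) :=
  Function.LeftInverse.injective (coord_param p)

theorem tendsto_coe_cobounded :
    Tendsto ((↑) : ℂ → Sphere) (Bornology.cobounded ℂ) (𝓝 OnePoint.infty) := by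
  rw [Metric.cobounded_eq_cocompact, ← coclosedCompact_eq_cocompact]
  exact OnePoint.tendsto_coe_infty

theorem continuous_param (p : Sphere) : Continuous (param p) := by
  induction p using OnePoint.rec with
  | infty =>
    rw [continuous_iff_continuousAt]
    intro w
    by_cases hw : w = 0
    · subst hw
      rw [← continuousWithinAt_compl_self, ContinuousWithinAt, param_zero]
      refine (tendsto_coe_cobounded.comp tendsto_inv₀_nhdsNE_zero).congr' ?_
      filter_upwards [self_mem_nhdsWithin] with w hw
      rw [param_infty, if_neg (show w ≠ 0 from hw)]
      rfl
    · have h1 : ContinuousAt (fun w : ℂ => ((w⁻¹ : ℂ) : Sphere)) w :=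
        OnePoint.continuous_coe.continuousAt.comp (continuousAt_inv₀ hw)
      refine h1.congr ?_
      filter_upwards [isOpen_ne.mem_nhds hw] with v hv
      rw [param_infty, if_neg hv]
  | coe a => exact OnePoint.continuous_coe.comp (continuous_const.add continuous_id)

theorem continuousAt_coord (p : Sphere) : ContinuousAt (coord p) p := by
  induction p using OnePoint.rec with
  | infty =>
    rw [OnePoint.continuousAt_infty', coord_self, coclosedCompact_eq_cocompact,
      ← Metric.cobounded_eq_cocompact]
    exact tendsto_inv₀_cobounded
  | coe a =>
    rw [OnePoint.continuousAt_coe]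
    exact (continuous_id.sub continuous_const).continuousAt

theorem tendsto_coord (p : Sphere) : Tendsto (coord p) (𝓝 p) (𝓝 0) := by
  have := (continuousAt_coord p).tendsto
  rwa [coord_self] at this

theorem eventually_param_coord (p : Sphere) : ∀ᶠ q in 𝓝 p, param p (coord p q) = q := by
  induction p using OnePoint.rec with
  | infty =>
    have : ∀ᶠ q : Sphere in 𝓝 OnePoint.infty, q ≠ ((0 : ℂ) : Sphere) :=
      isOpen_ne.mem_nhds (OnePoint.infty_ne_coe _)
    filter_upwards [this] with q hq
    induction q using OnePoint.rec with
    | infty => rw [coord_infty_infty, param_zero]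
    | coe z =>
      have hz : z ≠ 0 := fun h => hq (by rw [h])
      rw [coord_infty_coe, param_infty, if_neg (inv_ne_zero hz), inv_inv]
  | coe a =>
    have : ∀ᶠ q : Sphere in 𝓝 (a : Sphere), q ≠ OnePoint.infty :=
      isOpen_ne.mem_nhds (OnePoint.coe_ne_infty _)
    filter_upwards [this] with q hq
    induction q using OnePoint.rec with
    | infty => exact absurd rfl hq
    | coe z => rw [coord_coe_coe, param_coe, add_sub_cancel]

theorem tendsto_param (p : Sphere) : Tendsto (param p) (𝓝 0) (𝓝 p) := by
  have := (continuous_param p).tendsto 0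
  rwa [param_zero] at this

theorem continuousAt_of_continuousAt_param {Y : Type*} [TopologicalSpace Y] {p : Sphere}
    {f : Sphere → Y} (h : ContinuousAt (fun w => f (param p w)) 0) : ContinuousAt f p := by
  have h1 : Tendsto (fun q => f (param p (coord p q))) (𝓝 p) (𝓝 (f p)) := by
    have := h.tendsto.comp (tendsto_coord p)
    rwa [param_zero] at this
  refine h1.congr' ?_
  filter_upwards [eventually_param_coord p] with q hq
  rw [hq]

/-! ### Riemann maps of domains of the sphere -/

/-- `f` maps `B` conformally onto the unit disc with `f a = 0`, and `φ` is the inverse map.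
Here `f` takes values in `ℂ`, and `φ` is defined on `ℂ`; their values outside `B` and outside the
disc are irrelevant. -/
structure IsRiemannMap (B : Set Sphere) (a : Sphere) (f : Sphere → ℂ) (φ : ℂ → Sphere) : Prop where
  analyticAt : ∀ q ∈ B, AnalyticAt ℂ (fun w => f (param q w)) 0
  maps : Set.MapsTo f B (Metric.ball 0 1)
  maps_inv : Set.MapsTo φ (Metric.ball 0 1) B
  left_inv : ∀ q ∈ B, φ (f q) = q
  right_inv : ∀ w ∈ Metric.ball (0 : ℂ) 1, f (φ w) = w
  continuousAt_inv : ∀ w ∈ Metric.ball (0 : ℂ) 1, ContinuousAt φ w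
  analyticAt_inv : ∀ w ∈ Metric.ball (0 : ℂ) 1, AnalyticAt ℂ (fun v => coord (φ w) (φ v)) w
  zero : f a = 0

namespace IsRiemannMap

variable {B : Set Sphere} {a : Sphere} {f : Sphere → ℂ} {φ : ℂ → Sphere}

theorem continuousAt (h : IsRiemannMap B a f φ) {q : Sphere} (hq : q ∈ B) : ContinuousAt f q :=
  continuousAt_of_continuousAt_param (h.analyticAt q hq).continuousAt

theorem injOn (h : IsRiemannMap B a f φ) : Set.InjOn f B := fun p hp q hq e => by
  rw [← h.left_inv p hp, e, h.left_inv q hq]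

theorem inv_zero (h : IsRiemannMap B a f φ) (ha : a ∈ B) : φ 0 = a := by
  rw [← h.zero, h.left_inv a ha]

/-- The derivatives of `f` and of its inverse are reciprocal. -/
theorem deriv_mul_deriv_inv (h : IsRiemannMap B a f φ) (ha : a ∈ B) :
    deriv (fun w => f (param a w)) 0 * deriv (fun v => coord a (φ v)) 0 = 1 := by
  have h0 : (0 : ℂ) ∈ Metric.ball (0 : ℂ) 1 := Metric.mem_ball_self one_pos
  have e0 := h.inv_zero ha
  have h1 := h.analyticAt_inv 0 h0
  have hc := (h.continuousAt_inv 0 h0).tendsto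
  rw [e0] at h1 hc
  have e1 : coord a (φ 0) = 0 := by rw [e0, coord_self]
  have h2 : HasDerivAt (fun w => f (param a w)) (deriv (fun w => f (param a w)) 0)
      (coord a (φ 0)) := by
    rw [e1]
    exact (h.analyticAt a ha).differentiableAt.hasDerivAt
  have h3 := h2.comp (0 : ℂ) h1.differentiableAt.hasDerivAt
  refine h3.unique ((hasDerivAt_id (0 : ℂ)).congr_of_eventuallyEq ?_)
  filter_upwards [hc.eventually (eventually_param_coord a), Metric.ball_mem_nhds (0 : ℂ) one_pos]
    with v hv hvb
  simp only [Function.comp_apply, hv, id, h.right_inv v hvb]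

theorem deriv_ne_zero (h : IsRiemannMap B a f φ) (ha : a ∈ B) :
    deriv (fun w => f (param a w)) 0 ≠ 0 :=
  left_ne_zero_of_mul_eq_one (h.deriv_mul_deriv_inv ha)

/-- Rotating a Riemann map. -/
theorem rotate (h : IsRiemannMap B a f φ) {c : ℂ} (hc : ‖c‖ = 1) :
    IsRiemannMap B a (fun q => c * f q) (fun w => φ (c⁻¹ * w)) := by
  have hc0 : c ≠ 0 := norm_pos_iff.1 (by rw [hc]; exact one_pos)
  have hb : ∀ w ∈ Metric.ball (0 : ℂ) 1, c⁻¹ * w ∈ Metric.ball (0 : ℂ) 1 := fun w hw => by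
    simpa [hc] using hw
  refine ⟨fun q hq => analyticAt_const.mul (h.analyticAt q hq), fun q hq => ?_,
    fun w hw => h.maps_inv (hb w hw), fun q hq => ?_, fun w hw => ?_, fun w hw => ?_,
    fun w hw => ?_, ?_⟩
  · simpa [hc] using h.maps hq
  · rw [inv_mul_cancel_left₀ hc0, h.left_inv q hq]
  · rw [h.right_inv _ (hb w hw), mul_inv_cancel_left₀ hc0]
  · exact ContinuousAt.comp (f := fun w => c⁻¹ * w) (h.continuousAt_inv _ (hb w hw))
      (by fun_prop)
  · exact AnalyticAt.comp (f := fun w => c⁻¹ * w) (h.analyticAt_inv _ (hb w hw))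
      (analyticAt_const.mul analyticAt_id)
  · rw [h.zero, mul_zero]

end IsRiemannMap

/-- If an open nonempty set has a connected boundary, its complement is connected. -/
theorem isPreconnected_compl_of_frontier {X : Type*} [TopologicalSpace X] [PreconnectedSpace X]
    {B : Set X} (hB : IsOpen B) (hne : B.Nonempty) (hfr : IsPreconnected (frontier B)) :
    IsPreconnected Bᶜ := by
  have hsub : frontier B ⊆ Bᶜ := fun x hx hxB => by
    rw [hB.frontier_eq] at hx
    exact hx.2 hxB
  -- A closed piece of the complement which is separated from the boundary is open.
  have key : ∀ t t' : Set X, IsClosed t → IsClosed t' → Bᶜ ⊆ t ∪ t' → (Bᶜ ∩ t).Nonempty →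
      ¬ (Bᶜ ∩ (t ∩ t')).Nonempty → (frontier B ∩ t).Nonempty := by
    intro t t' ht ht' hsubt hnt hnn
    by_contra hfe
    have hC : Bᶜ ∩ t = (closure B)ᶜ ∩ t'ᶜ := by
      ext x
      constructor
      · rintro ⟨hxB, hxt⟩
        refine ⟨fun hxc => hfe ⟨x, ?_, hxt⟩, fun hxt' => hnn ⟨x, hxB, hxt, hxt'⟩⟩
        rw [hB.frontier_eq]
        exact ⟨hxc, hxB⟩
      · rintro ⟨hxc, hxt'⟩
        have hxB : x ∈ Bᶜ := fun h => hxc (subset_closure h)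
        exact ⟨hxB, (hsubt hxB).resolve_right hxt'⟩
    have hclopen : IsClopen (Bᶜ ∩ t) :=
      ⟨hB.isClosed_compl.inter ht, by
        rw [hC]
        exact isClosed_closure.isOpen_compl.inter ht'.isOpen_compl⟩
    rcases isClopen_iff.1 hclopen with h | h
    · exact hnt.ne_empty h
    · obtain ⟨x, hx⟩ := hne
      exact (h.symm ▸ Set.mem_univ x : x ∈ Bᶜ ∩ t).1 hx
  rw [isPreconnected_closed_iff]
  intro t t' ht ht' hsubt hnt hnt'
  by_contra hnn
  have h1 := key t t' ht ht' hsubt hnt hnn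
  have h2 := key t' t ht' ht (by rwa [Set.union_comm]) hnt' (by rwa [Set.inter_comm t'])
  obtain ⟨x, hx, hx'⟩ := isPreconnected_closed_iff.1 hfr t t' ht ht' (hsub.trans hsubt) h1 h2
  exact hnn ⟨x, hsub hx, hx'⟩

/-- The Möbius transformation `z ↦ 1 / (z - p)`, with values in `ℂ` (the value at the pole `p` is
irrelevant). -/
noncomputable def moebius (p : ℂ) (q : Sphere) : ℂ := q.elim 0 (fun z => (z - p)⁻¹)

/-- The inverse `w ↦ p + 1 / w` of `moebius p`. -/
noncomputable def moebiusInv (p w : ℂ) : Sphere :=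
  if w = 0 then OnePoint.infty else ((p + w⁻¹ : ℂ) : Sphere)

theorem moebius_coe (p z : ℂ) : moebius p (z : Sphere) = (z - p)⁻¹ := rfl

theorem moebius_infty (p : ℂ) : moebius p OnePoint.infty = 0 := rfl

theorem moebius_moebiusInv (p w : ℂ) : moebius p (moebiusInv p w) = w := by
  unfold moebiusInv
  split_ifs with h
  · rw [h, moebius_infty]
  · rw [moebius_coe, add_sub_cancel_left, inv_inv]

theorem moebiusInv_moebius {p : ℂ} {q : Sphere} (hq : q ≠ p) :
    moebiusInv p (moebius p q) = q := by
  induction q using OnePoint.rec with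
  | infty => simp [moebius_infty, moebiusInv]
  | coe z =>
    have hz : z - p ≠ 0 := sub_ne_zero.2 fun h => hq (by rw [h])
    rw [moebius_coe, moebiusInv, if_neg (inv_ne_zero hz), inv_inv, add_sub_cancel]

theorem moebiusInv_ne (p w : ℂ) : moebiusInv p w ≠ p := by
  unfold moebiusInv
  split_ifs with h
  · exact OnePoint.infty_ne_coe p
  · intro e
    have := OnePoint.coe_injective e
    simp [h] at this

theorem continuous_moebiusInv (p : ℂ) : Continuous (moebiusInv p) := by
  rw [continuous_iff_continuousAt]
  intro w
  by_cases hw : w = 0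
  · subst hw
    rw [← continuousWithinAt_compl_self, ContinuousWithinAt]
    have h0 : moebiusInv p 0 = OnePoint.infty := if_pos rfl
    rw [h0]
    have h1 : Tendsto (fun w : ℂ => p + w⁻¹) (𝓝[≠] 0) (Bornology.cobounded ℂ) :=
      (tendsto_const_add_cobounded p).comp tendsto_inv₀_nhdsNE_zero
    refine (tendsto_coe_cobounded.comp h1).congr' ?_
    filter_upwards [self_mem_nhdsWithin] with w hw
    rw [moebiusInv, if_neg (show w ≠ 0 from hw)]
    rfl
  · have h1 : ContinuousAt (fun w : ℂ => ((p + w⁻¹ : ℂ) : Sphere)) w :=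
      OnePoint.continuous_coe.continuousAt.comp (continuousAt_const.add (continuousAt_inv₀ hw))
    refine h1.congr ?_
    filter_upwards [isOpen_ne.mem_nhds hw] with v hv
    rw [moebiusInv, if_neg hv]

theorem analyticAt_moebius_param {p : ℂ} {q : Sphere} (hq : q ≠ p) :
    AnalyticAt ℂ (fun w => moebius p (param q w)) 0 := by
  induction q using OnePoint.rec with
  | infty =>
    have h1 : AnalyticAt ℂ (fun w : ℂ => w / (1 - p * w)) 0 :=
      analyticAt_id.div (analyticAt_const.sub (analyticAt_const.mul analyticAt_id)) (by simp)
    refine h1.congr (Eventually.of_forall fun w => ?_)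
    simp only [param_infty]
    split_ifs with hw
    · simp [hw, moebius_infty]
    · rw [moebius_coe, show 1 - p * w = w * (w⁻¹ - p) by field_simp, div_mul_eq_div_div,
        div_self hw, one_div]
  | coe z =>
    have hz : z - p ≠ 0 := sub_ne_zero.2 fun h => hq (by rw [h])
    have h1 : AnalyticAt ℂ (fun w : ℂ => (z + w - p)⁻¹) 0 :=
      ((analyticAt_const.add analyticAt_id).sub analyticAt_const).inv (by simpa using hz)
    exact h1

theorem analyticAt_coord_moebiusInv (p u : ℂ) :
    AnalyticAt ℂ (fun v => coord (moebiusInv p u) (moebiusInv p v)) u := by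
  by_cases hu : u = 0
  · subst hu
    have h0 : moebiusInv p 0 = OnePoint.infty := if_pos rfl
    rw [h0]
    have h1 : AnalyticAt ℂ (fun v : ℂ => v / (p * v + 1)) 0 :=
      analyticAt_id.div ((analyticAt_const.mul analyticAt_id).add analyticAt_const) (by simp)
    refine h1.congr (Eventually.of_forall fun v => ?_)
    simp only [moebiusInv]
    split_ifs with hv
    · simp [hv, coord_infty_infty]
    · rw [coord_infty_coe, show p * v + 1 = v * (p + v⁻¹) by field_simp, div_mul_eq_div_div,
        div_self hv, one_div]
  · have h0 : ∀ v ≠ 0, moebiusInv p v = ((p + v⁻¹ : ℂ) : Sphere) := fun v hv => if_neg hv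
    rw [h0 u hu]
    have h1 : AnalyticAt ℂ (fun v : ℂ => (p + v⁻¹) - (p + u⁻¹)) u :=
      (analyticAt_const.add (analyticAt_id.inv hu)).sub analyticAt_const
    refine h1.congr ?_
    filter_upwards [isOpen_ne.mem_nhds hu] with v hv
    rw [h0 v hv, coord_coe_coe]

theorem continuousAt_moebius {p : ℂ} {q : Sphere} (hq : q ≠ p) : ContinuousAt (moebius p) q :=
  continuousAt_of_continuousAt_param (analyticAt_moebius_param hq).continuousAt

/-- The complement of the image of `B` under `moebius p` in the sphere is the image of the complement
of `B` under the full Möbius transformation, which also maps `p` to `∞`. -/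
theorem isPreconnected_compl_image_moebius {p : ℂ} {B : Set Sphere} (hp : (p : Sphere) ∉ B)
    (hB : IsPreconnected Bᶜ) : IsPreconnected (((↑) : ℂ → Sphere) '' (moebiusInv p ⁻¹' B))ᶜ := by
  classical
  let τ : Sphere → Sphere := fun q => if q = p then OnePoint.infty else ((moebius p q : ℂ) : Sphere)
  have hτ : Continuous τ := by
    rw [continuous_iff_continuousAt]
    intro q
    by_cases hq : q = p
    · subst hq
      rw [OnePoint.continuousAt_coe, ← continuousWithinAt_compl_self, ContinuousWithinAt]
      have h0 : τ p = OnePoint.infty := if_pos rfl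
      simp only [Function.comp_apply, h0]
      have h1 : Tendsto (fun z : ℂ => z - p) (𝓝[≠] p) (𝓝[≠] 0) := by
        apply tendsto_nhdsWithin_of_tendsto_nhds_of_eventually_within
        · have : Continuous fun z : ℂ => z - p := by fun_prop
          simpa using (this.tendsto p).mono_left nhdsWithin_le_nhds
        · filter_upwards [self_mem_nhdsWithin] with z hz using sub_ne_zero.2 hz
      refine (tendsto_coe_cobounded.comp (tendsto_inv₀_nhdsNE_zero.comp h1)).congr' ?_
      filter_upwards [self_mem_nhdsWithin] with z hz
      have hz' : (z : Sphere) ≠ p := fun e => hz (OnePoint.coe_injective e)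
      simp only [Function.comp_apply, τ, if_neg hz', moebius_coe]
    · have h1 : ContinuousAt (fun q => ((moebius p q : ℂ) : Sphere)) q :=
        ContinuousAt.comp OnePoint.continuous_coe.continuousAt (continuousAt_moebius hq)
      refine h1.congr ?_
      filter_upwards [isOpen_ne.mem_nhds hq] with r hr
      simp only [τ, if_neg hr]
  have himg : (((↑) : ℂ → Sphere) '' (moebiusInv p ⁻¹' B))ᶜ = τ '' Bᶜ := by
    ext s
    constructor
    · intro hs
      induction s using OnePoint.rec with
      | infty => exact ⟨p, hp, if_pos rfl⟩
      | coe w =>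
        refine ⟨moebiusInv p w, fun h => hs ⟨w, h, rfl⟩, ?_⟩
        simp only [τ, if_neg (moebiusInv_ne p w), moebius_moebiusInv]
    · rintro ⟨q, hq, rfl⟩ ⟨w, hw, e⟩
      by_cases hqp : q = p
      · simp only [τ, if_pos hqp] at e
        exact OnePoint.coe_ne_infty w e
      · simp only [τ, if_neg hqp] at e
        rw [OnePoint.coe_injective e, Set.mem_preimage, moebiusInv_moebius hqp] at hw
        exact hq hw
  rw [himg]
  exact hB.image τ hτ.continuousOn

/-- The Riemann mapping theorem for domains of hyperbolic type. -/
theorem exists_isRiemannMap {B : Set Sphere} (hB : IsHyperbolicType B) {a : Sphere} (ha : a ∈ B) :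
    ∃ f φ, IsRiemannMap B a f φ := by
  obtain ⟨q₁, h₁, q₂, h₂, h12⟩ := hB.boundary_nontrivial
  have hfr : ∀ q ∈ frontier B, q ∉ B := fun q hq hqB => by
    rw [hB.isOpen.frontier_eq] at hq
    exact hq.2 hqB
  obtain ⟨p, hpB, q, hqB, hqp⟩ : ∃ p : ℂ, (p : Sphere) ∉ B ∧ ∃ q ∉ B, q ≠ (p : Sphere) := by
    induction q₁ using OnePoint.rec with
    | infty =>
      induction q₂ using OnePoint.rec with
      | infty => exact absurd rfl h12
      | coe p => exact ⟨p, hfr _ h₂, _, hfr _ h₁, h12⟩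
    | coe p => exact ⟨p, hfr _ h₁, _, hfr _ h₂, h12.symm⟩
  have hBp : ∀ s ∈ B, s ≠ (p : Sphere) := fun s hs e => hpB (e ▸ hs)
  set U : Set ℂ := moebiusInv p ⁻¹' B
  have hU : IsOpen U := hB.isOpen.preimage (continuous_moebiusInv p)
  have hmem : ∀ s ∈ B, moebius p s ∈ U := fun s hs => by
    rw [Set.mem_preimage, moebiusInv_moebius (hBp s hs)]
    exact hs
  have hUimg : U = moebius p '' B := by
    ext w
    constructor
    · intro hw
      exact ⟨_, hw, moebius_moebiusInv p w⟩
    · rintro ⟨s, hs, rfl⟩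
      exact hmem s hs
  have hUc : IsConnected U := by
    rw [hUimg]
    exact hB.isConnected.image _ fun s hs => (continuousAt_moebius (hBp s hs)).continuousWithinAt
  have hne : U ≠ Set.univ := by
    intro h
    have : moebius p q ∈ U := h ▸ Set.mem_univ _
    rw [Set.mem_preimage, moebiusInv_moebius hqp] at this
    exact hqB this
  have hK := isPreconnected_compl_image_moebius hpB
    (isPreconnected_compl_of_frontier hB.isOpen ⟨a, ha⟩ hB.boundary_connected)
  have hex := fun f (hf : DifferentiableOn ℂ f U) =>
    isExactOn_of_isPreconnected_compl hU hUc hK hne hf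
  obtain ⟨R, hR, hRU⟩ := exists_isDiscMap_image_eq hU hUc.isPreconnected hne
    (fun g hg hg0 => exists_sq_eq_of_isExactOn hU hUc hex hg hg0) (hmem a ha)
  have hl : Set.LeftInvOn (Function.invFunOn R U) R U := hR.inj.leftInvOn_invFunOn
  set S := Function.invFunOn R U
  have hball : ∀ w ∈ Metric.ball (0 : ℂ) 1, S w ∈ U ∧ R (S w) = w := by
    intro w hw
    rw [← hRU] at hw
    obtain ⟨z, hz, rfl⟩ := hw
    rw [hl hz]
    exact ⟨hz, rfl⟩
  have hSd : DifferentiableOn ℂ S (Metric.ball 0 1) := by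
    intro w hw
    have := differentiableAt_of_leftInvOn hU hR.diff hR.inj hl (hball w hw).1
    rw [(hball w hw).2] at this
    exact this.differentiableWithinAt
  have hSa : ∀ w ∈ Metric.ball (0 : ℂ) 1, AnalyticAt ℂ S w := fun w hw =>
    hSd.analyticAt (Metric.isOpen_ball.mem_nhds hw)
  refine ⟨fun s => R (moebius p s), fun w => moebiusInv p (S w), fun s hs => ?_,
    fun s hs => hR.maps (hmem s hs), fun w hw => (hball w hw).1, fun s hs => ?_, fun w hw => ?_,
    fun w hw => ?_, fun w hw => ?_, hR.zero⟩
  · refine AnalyticAt.comp (g := R) (f := fun w => moebius p (param s w)) ?_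
      (analyticAt_moebius_param (hBp s hs))
    rw [param_zero]
    exact hR.diff.analyticAt (hU.mem_nhds (hmem s hs))
  · simp only [hl (hmem s hs), moebiusInv_moebius (hBp s hs)]
  · simp only [moebius_moebiusInv, (hball w hw).2]
  · exact (continuous_moebiusInv p).continuousAt.comp (hSa w hw).continuousAt
  · exact AnalyticAt.comp (g := fun v => coord (moebiusInv p (S w)) (moebiusInv p v)) (f := S)
      (analyticAt_coord_moebiusInv p (S w)) (hSa w hw)

/-- A Riemann map can be normalized by a rotation so that its derivative at `a` is positive. -/
theorem exists_isRiemannMap_deriv_pos {B : Set Sphere} (hB : IsHyperbolicType B) {a : Sphere}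
    (ha : a ∈ B) : ∃ f φ, IsRiemannMap B a f φ ∧
      ∃ c : ℝ, 0 < c ∧ deriv (fun w => f (param a w)) 0 = c := by
  obtain ⟨f, φ, h⟩ := exists_isRiemannMap hB ha
  set d := deriv (fun w => f (param a w)) 0 with hd
  have hd0 : d ≠ 0 := h.deriv_ne_zero ha
  have hdn : (‖d‖ : ℂ) ≠ 0 := by exact_mod_cast norm_ne_zero_iff.2 hd0
  refine ⟨_, _, h.rotate (c := ‖d‖ / d) ?_, ‖d‖, norm_pos_iff.2 hd0, ?_⟩
  · rw [norm_div, Complex.norm_real, norm_norm, div_self (norm_ne_zero_iff.2 hd0)]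
  · rw [deriv_const_mul _ (h.analyticAt a ha).differentiableAt, ← hd, div_mul_cancel₀ _ hd0]

/-! ### The Green function and the inner radius -/

open InnerProductSpace (HarmonicAt HarmonicOnNhd)

theorem harmonicAt_comp_analyticAt {u : ℂ → ℝ} {g : ℂ → ℂ} {w : ℂ} (hu : HarmonicAt u (g w))
    (hg : AnalyticAt ℂ g w) : HarmonicAt (fun v => u (g v)) w := by
  obtain ⟨r, hr, hball⟩ := Metric.eventually_nhds_iff_ball.1 hu.eventually
  obtain ⟨F, hF, hFu⟩ := InnerProductSpace.HarmonicOnNhd.exists_analyticOnNhd_ball_re_eq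
    (f := u) (z := g w) (R := r) hball
  have h1 := ((hF (g w) (Metric.mem_ball_self hr)).comp hg).harmonicAt_re
  refine (InnerProductSpace.harmonicAt_congr_nhds ?_).1 h1
  filter_upwards [hg.continuousAt.eventually (Metric.ball_mem_nhds (g w) hr)] with v hv
    using hFu hv

/-- The minimum principle for harmonic functions in the unit disc with nonnegative boundary values,
in the form needed for Green functions. -/
theorem nonneg_of_harmonicOnNhd_ball {v : ℂ → ℝ} (hv : HarmonicOnNhd v (Metric.ball 0 1))
    (hlog : ∀ w ∈ Metric.ball (0 : ℂ) 1, w ≠ 0 → Real.log ‖w‖ ≤ v w) {w : ℂ}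
    (hw : w ∈ Metric.ball (0 : ℂ) 1) : 0 ≤ v w := by
  obtain ⟨F, hF, hFv⟩ := hv.exists_analyticOnNhd_ball_re_eq
  have hw1 : ‖w‖ < 1 := by simpa using hw
  -- The maximum modulus principle for `exp (-F)` in the disc of radius `ρ`.
  have key : ∀ ρ : ℝ, ‖w‖ < ρ → ρ < 1 → Real.log ρ ≤ v w := by
    intro ρ h1 h2
    have hρ : 0 < ρ := (norm_nonneg w).trans_lt h1
    have hsub : Metric.closedBall (0 : ℂ) ρ ⊆ Metric.ball 0 1 := Metric.closedBall_subset_ball h2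
    have hd : DiffContOnCl ℂ (fun z => Complex.exp (-F z)) (Metric.ball 0 ρ) := by
      apply DifferentiableOn.diffContOnCl
      rw [closure_ball _ hρ.ne']
      exact ((hF.differentiableOn.mono hsub).neg).cexp
    have hn : ∀ z ∈ Metric.ball (0 : ℂ) 1, ‖Complex.exp (-F z)‖ = Real.exp (-v z) := by
      intro z hz
      rw [Complex.norm_exp, Complex.neg_re, ← hFv hz]
    have := Complex.norm_le_of_forall_mem_frontier_norm_le Metric.isBounded_ball hd
      (C := Real.exp (-Real.log ρ)) (fun z hz => by
        rw [frontier_ball _ hρ.ne'] at hz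
        have hz' : ‖z‖ = ρ := by simpa using hz
        have hzb := hsub (Metric.sphere_subset_closedBall hz)
        rw [hn z hzb]
        apply Real.exp_le_exp.2
        have := hlog z hzb (norm_pos_iff.1 (by rw [hz']; exact hρ))
        rw [hz'] at this
        linarith) (subset_closure (show w ∈ Metric.ball (0 : ℂ) ρ by simpa using h1))
    rw [hn w hw] at this
    linarith [Real.exp_le_exp.1 this]
  have hlim : Tendsto Real.log (𝓝[<] 1) (𝓝 0) := by
    have := (Real.continuousAt_log one_ne_zero).tendsto
    rw [Real.log_one] at this
    exact this.mono_left nhdsWithin_le_nhds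
  refine le_of_tendsto hlim ?_
  filter_upwards [Ioo_mem_nhdsLT hw1] with ρ hρ using key ρ hρ.1 hρ.2

/-- Near a simple zero, `log |F(w)| - log |w|` is the harmonic function `log |F(w) / w|`. -/
theorem dslope_zero_spec {F : ℂ → ℂ} (hF : AnalyticAt ℂ F 0) (h0 : F 0 = 0)
    (hd : deriv F 0 ≠ 0) :
    AnalyticAt ℂ (dslope F 0) 0 ∧ dslope F 0 0 ≠ 0 ∧
      ∀ᶠ w in 𝓝[≠] (0 : ℂ), F w ≠ 0 ∧
        Real.log ‖F w‖ = Real.log ‖w‖ + Real.log ‖dslope F 0 w‖ := by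
  have hk : AnalyticAt ℂ (dslope F 0) 0 := by
    rw [Complex.analyticAt_iff_eventually_differentiableAt]
    obtain ⟨r, hr, hball⟩ := Metric.eventually_nhds_iff_ball.1
      (Complex.analyticAt_iff_eventually_differentiableAt.1 hF)
    have h1 : DifferentiableOn ℂ (dslope F 0) (Metric.ball 0 r) :=
      (Complex.differentiableOn_dslope (Metric.ball_mem_nhds 0 hr)).2
        fun z hz => (hball z hz).differentiableWithinAt
    filter_upwards [Metric.isOpen_ball.mem_nhds (Metric.mem_ball_self hr)] with z hz
      using h1.differentiableAt (Metric.isOpen_ball.mem_nhds hz)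
  have hk0 : dslope F 0 0 ≠ 0 := by rwa [dslope_same]
  refine ⟨hk, hk0, ?_⟩
  filter_upwards [self_mem_nhdsWithin,
    nhdsWithin_le_nhds (hk.continuousAt.eventually_ne hk0)] with w hw hkw
  have hw' : w ≠ 0 := hw
  have e : F w = w * dslope F 0 w := by
    have := sub_smul_dslope F 0 w
    simp only [sub_zero, smul_eq_mul, h0] at this
    exact this.symm
  refine ⟨by rw [e]; exact mul_ne_zero hw' hkw, ?_⟩
  rw [e, norm_mul, Real.log_mul (norm_ne_zero_iff.2 hw') (norm_ne_zero_iff.2 hkw)]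

namespace IsRiemannMap

variable {B : Set Sphere} {a : Sphere} {f : Sphere → ℂ} {φ : ℂ → Sphere}

theorem apply_ne_zero (h : IsRiemannMap B a f φ) (ha : a ∈ B) {q : Sphere} (hq : q ∈ B \ {a}) :
    f q ≠ 0 := fun e => hq.2 (h.injOn hq.1 ha (by rw [e, h.zero]))

theorem norm_lt_one (h : IsRiemannMap B a f φ) {q : Sphere} (hq : q ∈ B) : ‖f q‖ < 1 := by
  simpa using h.maps hq

theorem isPositiveWithLogPole (h : IsRiemannMap B a f φ) (ha : a ∈ B) :
    IsPositiveWithLogPole B a (fun q => -Real.log ‖f q‖) := by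
  refine ⟨fun q hq => ?_, fun q hq => ?_, ?_⟩
  · have h1 : f (param q 0) ≠ 0 := by rw [param_zero]; exact h.apply_ne_zero ha hq
    exact ((h.analyticAt q hq.1).harmonicAt_log_norm h1).neg
  · exact neg_pos.2 (Real.log_neg (norm_pos_iff.2 (h.apply_ne_zero ha hq)) (h.norm_lt_one hq.1))
  · obtain ⟨h1, h2, h3⟩ := dslope_zero_spec (h.analyticAt a ha)
      (by rw [param_zero, h.zero]) (h.deriv_ne_zero ha)
    refine ⟨_, (h1.harmonicAt_log_norm h2).neg, ?_⟩
    filter_upwards [h3] with w hw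
    rw [hw.2, Pi.neg_apply]
    ring

/-- Transplanted to the disc, a positive harmonic function with a logarithmic pole dominates
`-log |w|`, by the minimum principle applied to the difference. -/
theorem neg_log_norm_le (h : IsRiemannMap B a f φ) (ha : a ∈ B) {g : Sphere → ℝ}
    (hg : IsPositiveWithLogPole B a g) {q : Sphere} (hq : q ∈ B \ {a}) :
    -Real.log ‖f q‖ ≤ g q := by
  classical
  have h0 : (0 : ℂ) ∈ Metric.ball (0 : ℂ) 1 := Metric.mem_ball_self one_pos
  obtain ⟨u, hu, hug⟩ := hg.pole
  set θ : ℂ → ℂ := fun v => coord a (φ v)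
  have hφ0 := h.inv_zero ha
  have hθ0 : θ 0 = 0 := by simp only [θ, hφ0, coord_self]
  have hθ : AnalyticAt ℂ θ 0 := by
    have := h.analyticAt_inv 0 h0
    rwa [hφ0] at this
  have hφc : Tendsto φ (𝓝 0) (𝓝 a) := by
    have := (h.continuousAt_inv 0 h0).tendsto
    rwa [hφ0] at this
  obtain ⟨h1, h2, h3⟩ := dslope_zero_spec hθ hθ0
    (right_ne_zero_of_mul_eq_one (h.deriv_mul_deriv_inv ha))
  let v : ℂ → ℝ := fun w =>
    if w = 0 then u 0 - Real.log ‖dslope θ 0 0‖ else g (φ w) + Real.log ‖w‖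
  have hne : ∀ w ∈ Metric.ball (0 : ℂ) 1, w ≠ 0 → φ w ∈ B \ {a} := fun w hw hw0 =>
    ⟨h.maps_inv hw, fun e => hw0 (by
      have e' : φ w = a := e
      rw [← h.right_inv w hw, e', h.zero])⟩
  have hv : HarmonicOnNhd v (Metric.ball 0 1) := by
    intro w hw
    by_cases hw0 : w = 0
    · subst hw0
      have hu' : HarmonicAt (fun w => u (θ w)) 0 :=
        harmonicAt_comp_analyticAt (by rwa [hθ0]) hθ
      refine (InnerProductSpace.harmonicAt_congr_nhds ?_).1 (hu'.sub (h1.harmonicAt_log_norm h2))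
      have hθn : Tendsto θ (𝓝[≠] 0) (𝓝[≠] 0) := by
        apply tendsto_nhdsWithin_of_tendsto_nhds_of_eventually_within
        · have := hθ.continuousAt.tendsto
          rw [hθ0] at this
          exact this.mono_left nhdsWithin_le_nhds
        · exact h3.mono fun w hw => hw.1
      have h4 := eventually_nhdsWithin_iff.1 (h3.and (hθn.eventually hug))
      filter_upwards [h4, hφc.eventually (eventually_param_coord a)] with w hw5 hw6
      by_cases hw0 : w = 0
      · subst hw0
        simp [v, hθ0]
      · obtain ⟨⟨-, h7⟩, h8⟩ := hw5 hw0
        simp only [v, if_neg hw0, Pi.sub_apply]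
        rw [show g (φ w) = g (param a (θ w)) by simp only [θ, hw6], h8, h7]
        ring
    · have h4 : HarmonicAt (fun v => g (param (φ w) (coord (φ w) (φ v)))) w := by
        refine harmonicAt_comp_analyticAt (u := fun x => g (param (φ w) x)) ?_
          (h.analyticAt_inv w hw)
        rw [coord_self]
        exact hg.harmonic _ (hne w hw hw0)
      refine (InnerProductSpace.harmonicAt_congr_nhds ?_).1
        (h4.add ((analyticAt_id (z := w)).harmonicAt_log_norm hw0))
      filter_upwards [(h.continuousAt_inv w hw).eventually (eventually_param_coord (φ w)),
        isOpen_ne.mem_nhds hw0] with x hx hx0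
      simp only [v, if_neg hx0, Pi.add_apply, hx, id]
  have hfq0 := h.apply_ne_zero ha hq
  have hmain : 0 ≤ v (f q) := by
    refine nonneg_of_harmonicOnNhd_ball hv (fun w hw hw0 => ?_) (h.maps hq.1)
    simp only [v, if_neg hw0]
    have := hg.pos _ (hne w hw hw0)
    linarith
  simp only [v, if_neg hfq0, h.left_inv q hq.1] at hmain
  linarith

theorem greenFunction_eq (h : IsRiemannMap B a f φ) (ha : a ∈ B) {q : Sphere}
    (hq : q ∈ B \ {a}) : greenFunction B a q = -Real.log ‖f q‖ := by
  refine IsLeast.csInf_eq ⟨⟨_, h.isPositiveWithLogPole ha, rfl⟩, ?_⟩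
  rintro _ ⟨g, hg, rfl⟩
  exact h.neg_log_norm_le ha hg hq

theorem innerRadius_eq (h : IsRiemannMap B a f φ) (hB : IsOpen B) (ha : a ∈ B) :
    innerRadius B a = ‖deriv (fun w => f (param a w)) 0‖⁻¹ := by
  obtain ⟨h1, h2, h3⟩ := dslope_zero_spec (h.analyticAt a ha)
    (by rw [param_zero, h.zero]) (h.deriv_ne_zero ha)
  have hlim : Tendsto (fun w : ℂ => greenFunction B a (param a w) + Real.log ‖w‖) (𝓝[≠] 0)
      (𝓝 (-Real.log ‖deriv (fun w => f (param a w)) 0‖)) := by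
    have h4 : Tendsto (fun w => -Real.log ‖dslope (fun w => f (param a w)) 0 w‖) (𝓝 0)
        (𝓝 (-Real.log ‖deriv (fun w => f (param a w)) 0‖)) := by
      have := (h1.continuousAt.norm.log (norm_ne_zero_iff.2 h2)).neg.tendsto
      simp only [Pi.neg_apply, dslope_same] at this
      exact this
    refine (h4.mono_left nhdsWithin_le_nhds).congr' ?_
    filter_upwards [h3, self_mem_nhdsWithin,
      nhdsWithin_le_nhds ((tendsto_param a).eventually (hB.mem_nhds ha))] with w hw hw0 hwB
    have : param a w ≠ a := fun e => hw0 (param_injective a (by rw [e, param_zero]))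
    rw [h.greenFunction_eq ha ⟨hwB, this⟩, hw.2]
    ring
  rw [innerRadius, hlim.limUnder_eq, Real.exp_neg,
    Real.exp_log (norm_pos_iff.2 (h.deriv_ne_zero ha))]

end IsRiemannMap

/-! ### Coordinatewise maps of the infinite product of spheres -/

theorem continuous_sphereProd_apply (k : ℕ) : Continuous (fun Z : SphereProd => Z k) := by
  let _ : UniformSpace Sphere := uniformSpaceOfCompactR1
  exact (UniformFun.uniformContinuous_eval Sphere k).continuous.comp continuous_induced_dom

theorem SphereProd.replace_self (Z : SphereProd) (k : ℕ) (t : Sphere) : Z.replace k t k = t :=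
  Function.update_self (β := fun _ => Sphere) k t Z

theorem SphereProd.replace_of_ne (Z : SphereProd) {k j : ℕ} (h : j ≠ k) (t : Sphere) :
    Z.replace k t j = Z j :=
  Function.update_of_ne (β := fun _ => Sphere) h t Z

theorem SphereProd.replace_replace (Z : SphereProd) (k : ℕ) (s t : Sphere) :
    (Z.replace k s).replace k t = Z.replace k t :=
  Function.update_idem (β := fun _ => Sphere) s t Z

theorem replace_mem_polycylinder {B : ℕ → Set Sphere} {Z : SphereProd} (hZ : Z ∈ polycylinder B)
    {k : ℕ} {t : Sphere} (ht : t ∈ B k) : Z.replace k t ∈ polycylinder B := by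
  intro j
  by_cases h : j = k
  · subst h
    rwa [SphereProd.replace_self]
  · rw [SphereProd.replace_of_ne Z h]
    exact hZ j

/-- A map which is holomorphic in each coordinate separately is holomorphic: its mixed partial
derivatives vanish, and the others depend on a single coordinate only. -/
theorem holomorphicMapOn_coordMap {f : ℕ → Sphere → Sphere} {B : ℕ → Set Sphere}
    (hc : ∀ k, ∀ p ∈ B k, ContinuousAt (f k) p)
    (ha : ∀ k, ∀ p ∈ B k, AnalyticAt ℂ (fun w => coord (f k p) (f k (param p w))) 0) :
    HolomorphicMapOn (coordMap f) (polycylinder B) := by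
  refine ⟨fun k Z hZ => ?_, fun Z hZ k p => ?_, fun Z hZ k p => ?_⟩
  · exact (ContinuousAt.comp (f := fun Z : SphereProd => Z k) (hc k _ (hZ k))
      (continuous_sphereProd_apply k).continuousAt).continuousWithinAt
  · by_cases h : k = p
    · subst h
      simp only [coordMap, SphereProd.replace_self]
      exact ⟨hc k _ (hZ k), (ha k _ (hZ k)).differentiableAt⟩
    · simp only [coordMap, SphereProd.replace_of_ne Z h]
      exact ⟨continuousAt_const, differentiableAt_const _⟩
  · by_cases h : k = p
    · subst h
      simp only [coordMap, SphereProd.replace_self]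
      have h1 : ContinuousAt (deriv fun w => coord (f k (Z k)) (f k (param (Z k) w)))
          (coord (Z k) (Z k)) := by
        rw [coord_self]
        exact (ha k _ (hZ k)).deriv.continuousAt
      have h2 : ContinuousAt (fun W : SphereProd => coord (Z k) (W k)) Z :=
        ContinuousAt.comp (f := fun Z : SphereProd => Z k) (continuousAt_coord (Z k))
          (continuous_sphereProd_apply k).continuousAt
      exact (ContinuousAt.comp (f := fun W : SphereProd => coord (Z k) (W k)) h1
        h2).continuousWithinAt
    · simp only [coordMap, SphereProd.replace_of_ne _ h, deriv_const]
      exact continuousWithinAt_const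

theorem coe_mem_unitDisc {w : ℂ} : (w : Sphere) ∈ unitDisc ↔ w ∈ Metric.ball (0 : ℂ) 1 :=
  OnePoint.coe_injective.mem_set_image

theorem coord_zero_coe (w : ℂ) : coord ((0 : ℂ) : Sphere) (w : Sphere) = w := by
  rw [coord_coe_coe, sub_zero]

/-! ### Riemann maps as maps of the sphere -/

namespace IsRiemannMap

variable {B : Set Sphere} {a : Sphere} {f : Sphere → ℂ} {φ : ℂ → Sphere}

theorem analyticAt_coord (h : IsRiemannMap B a f φ) {p : Sphere} (hp : p ∈ B) :
    AnalyticAt ℂ (fun w => coord (f p : Sphere) (f (param p w) : Sphere)) 0 := by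
  simp only [coord_coe_coe]
  exact (h.analyticAt p hp).sub analyticAt_const

theorem continuousAt_coe (h : IsRiemannMap B a f φ) {p : Sphere} (hp : p ∈ B) :
    ContinuousAt (fun q => (f q : Sphere)) p :=
  ContinuousAt.comp OnePoint.continuous_coe.continuousAt (h.continuousAt hp)

theorem univalentOn (h : IsRiemannMap B a f φ) : UnivalentOn (fun q => (f q : Sphere)) B :=
  ⟨fun _ hp => ⟨h.continuousAt_coe hp, (h.analyticAt_coord hp).differentiableAt⟩,
    OnePoint.coe_injective.comp_injOn h.injOn⟩

theorem image_eq_unitDisc (h : IsRiemannMap B a f φ) : (fun q => (f q : Sphere)) '' B = unitDisc := by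
  ext s
  constructor
  · rintro ⟨q, hq, rfl⟩
    exact coe_mem_unitDisc.2 (h.maps hq)
  · rintro ⟨w, hw, rfl⟩
    exact ⟨φ w, h.maps_inv hw, by simp only [h.right_inv w hw]⟩

theorem sphereDeriv_coe (h : IsRiemannMap B a f φ) :
    sphereDeriv (fun q => (f q : Sphere)) a = deriv (fun w => f (param a w)) 0 := by
  simp only [sphereDeriv, coord_coe_coe, h.zero, sub_zero]

/-- The inverse Riemann map, extended to the sphere in an irrelevant way, is continuous in the
disc. -/
theorem continuousAt_inv_coord (h : IsRiemannMap B a f φ) {s : Sphere} (hs : s ∈ unitDisc) :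
    ContinuousAt (fun s => φ (coord ((0 : ℂ) : Sphere) s)) s := by
  obtain ⟨w, hw, rfl⟩ := hs
  rw [OnePoint.continuousAt_coe]
  simp only [Function.comp_def, coord_zero_coe]
  exact h.continuousAt_inv w hw

theorem analyticAt_inv_coord (h : IsRiemannMap B a f φ) {s : Sphere} (hs : s ∈ unitDisc) :
    AnalyticAt ℂ (fun w => coord (φ (coord ((0 : ℂ) : Sphere) s))
      (φ (coord ((0 : ℂ) : Sphere) (param s w)))) 0 := by
  obtain ⟨w, hw, rfl⟩ := hs
  simp only [param_coe, coord_zero_coe]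
  refine AnalyticAt.comp (g := fun v => coord (φ w) (φ v)) (f := fun x => w + x) ?_
    (analyticAt_const.add analyticAt_id)
  rw [add_zero]
  exact h.analyticAt_inv w hw

theorem univalentOn_inv (h : IsRiemannMap B a f φ) :
    UnivalentOn (fun s => φ (coord ((0 : ℂ) : Sphere) s)) unitDisc := by
  refine ⟨fun s hs => ⟨h.continuousAt_inv_coord hs, (h.analyticAt_inv_coord hs).differentiableAt⟩,
    ?_⟩
  rintro _ ⟨w, hw, rfl⟩ _ ⟨v, hv, rfl⟩ e
  simp only [coord_zero_coe] at e
  rw [← h.right_inv w hw, e, h.right_inv v hv]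

theorem norm_sphereDeriv_inv (h : IsRiemannMap B a f φ) (hB : IsOpen B) (ha : a ∈ B) :
    ‖sphereDeriv (fun s => φ (coord ((0 : ℂ) : Sphere) s)) ((0 : ℂ) : Sphere)‖ =
      innerRadius B a := by
  rw [h.innerRadius_eq hB ha, ← norm_inv]
  congr 1
  simp only [sphereDeriv, param_coe, coord_zero_coe, zero_add, h.inv_zero ha]
  exact eq_inv_of_mul_eq_one_right (h.deriv_mul_deriv_inv ha)

/-- A conformal map `g` of `B` onto the disc with the same normalization as `f` equals `f`: both
`g ∘ f⁻¹` and its inverse are self-maps of the disc which fix `0`, and by the Schwarz lemma the first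
one is the identity. -/
theorem eq_of_normalized (h : IsRiemannMap B a f φ) (ha : a ∈ B) {c : ℝ} (hc : 0 < c)
    (hfc : deriv (fun w => f (param a w)) 0 = c) {g γ : Sphere → Sphere}
    (hg : ∀ p ∈ B, HolomorphicAtPt g p) (hγ : ∀ s ∈ unitDisc, HolomorphicAtPt γ s)
    (hgm : Set.MapsTo g B unitDisc) (hγm : Set.MapsTo γ unitDisc B) (hinv : Set.InvOn γ g B unitDisc)
    (hga : g a = ((0 : ℂ) : Sphere)) (hre : 0 < (sphereDeriv g a).re)
    (him : (sphereDeriv g a).im = 0) {p : Sphere} (hp : p ∈ B) : g p = (f p : Sphere) := by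
  have h0 : (0 : ℂ) ∈ Metric.ball (0 : ℂ) 1 := Metric.mem_ball_self one_pos
  let H : ℂ → ℂ := fun w => coord ((0 : ℂ) : Sphere) (g (φ w))
  let K : ℂ → ℂ := fun w => f (γ (w : Sphere))
  have hH : ∀ w ∈ Metric.ball (0 : ℂ) 1, g (φ w) = (H w : Sphere) ∧
      H w ∈ Metric.ball (0 : ℂ) 1 := by
    intro w hw
    obtain ⟨v, hv, e⟩ := hgm (h.maps_inv hw)
    simp only [H, ← e, coord_zero_coe]
    exact ⟨trivial, hv⟩
  have hφ0 := h.inv_zero ha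
  have hH0 : H 0 = 0 := by simp only [H, hφ0, hga, coord_zero_coe]
  have hK0 : K 0 = 0 := by simp only [K, ← hga, hinv.1 ha, h.zero]
  have hHder : ∀ w ∈ Metric.ball (0 : ℂ) 1, HasDerivAt H
      (sphereDeriv g (φ w) * deriv (fun v => coord (φ w) (φ v)) w) w := by
    intro w hw
    have h1 : HasDerivAt (fun x => coord (g (φ w)) (g (param (φ w) x)))
        (sphereDeriv g (φ w)) (coord (φ w) (φ w)) := by
      rw [coord_self]
      exact (hg _ (h.maps_inv hw)).2.hasDerivAt
    have h2 := (h1.comp w (h.analyticAt_inv w hw).differentiableAt.hasDerivAt).add_const (H w)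
    refine h2.congr_of_eventuallyEq ?_
    filter_upwards [(h.continuousAt_inv w hw).eventually (eventually_param_coord (φ w)),
      Metric.isOpen_ball.mem_nhds hw] with v hv hvb
    simp only [Function.comp_apply, hv, (hH w hw).1, (hH v hvb).1, coord_coe_coe, sub_add_cancel]
  have hHd : DifferentiableOn ℂ H (Metric.ball 0 1) := fun w hw =>
    (hHder w hw).differentiableAt.differentiableWithinAt
  have hKd : DifferentiableOn ℂ K (Metric.ball 0 1) := by
    intro w hw
    apply DifferentiableAt.differentiableWithinAt
    have hwD := coe_mem_unitDisc.2 hw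
    have h1 := (hγ _ hwD).2
    simp only [param_coe] at h1
    have h2 : DifferentiableAt ℂ (fun v : ℂ => coord (γ (w : Sphere)) (γ (v : Sphere))) w := by
      have h3 : DifferentiableAt ℂ
          (fun x : ℂ => coord (γ (w : Sphere)) (γ ((w + x : ℂ) : Sphere))) (w - w) := by
        rwa [sub_self]
      have h4 := DifferentiableAt.comp (f := fun v : ℂ => v - w) w h3
        (differentiableAt_id.sub_const w)
      simpa only [Function.comp_def, add_sub_cancel] using h4
    have h5 : DifferentiableAt ℂ (fun x => f (param (γ (w : Sphere)) x))
        (coord (γ (w : Sphere)) (γ (w : Sphere))) := by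
      rw [coord_self]
      exact (h.analyticAt _ (hγm hwD)).differentiableAt
    refine (DifferentiableAt.comp (g := fun x => f (param (γ (w : Sphere)) x)) w h5
      h2).congr_of_eventuallyEq ?_
    have h6 : ContinuousAt (fun v : ℂ => γ (v : Sphere)) w :=
      ContinuousAt.comp (g := γ) (hγ _ hwD).1 OnePoint.continuous_coe.continuousAt
    filter_upwards [h6.eventually (eventually_param_coord (γ (w : Sphere)))] with v hv
    simp only [Function.comp_apply, hv, K]
  have hKm : Set.MapsTo K (Metric.ball 0 1) (Metric.ball 0 1) := fun w hw =>
    h.maps (hγm (coe_mem_unitDisc.2 hw))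
  have hHm : Set.MapsTo H (Metric.ball 0 1) (Metric.ball 0 1) := fun w hw => (hH w hw).2
  have hKH : ∀ w ∈ Metric.ball (0 : ℂ) 1, K (H w) = w := by
    intro w hw
    simp only [K, ← (hH w hw).1, hinv.1 (h.maps_inv hw), h.right_inv w hw]
  have hH1 : ‖deriv H 0‖ ≤ 1 := by
    have := Complex.norm_deriv_le_div_of_mapsTo_ball (c := 0) hHd (R₂ := 1)
      (by rw [hH0]; exact hHm.mono_right Metric.ball_subset_closedBall) one_pos
    simpa using this
  have hK1 : ‖deriv K 0‖ ≤ 1 := by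
    have := Complex.norm_deriv_le_div_of_mapsTo_ball (c := 0) hKd (R₂ := 1)
      (by rw [hK0]; exact hKm.mono_right Metric.ball_subset_closedBall) one_pos
    simpa using this
  have hprod : deriv K 0 * deriv H 0 = 1 := by
    have h1 : HasDerivAt K (deriv K 0) (H 0) := by
      rw [hH0]
      exact (hKd.differentiableAt (Metric.isOpen_ball.mem_nhds h0)).hasDerivAt
    have h2 := h1.comp (0 : ℂ) (hHd.differentiableAt (Metric.isOpen_ball.mem_nhds h0)).hasDerivAt
    refine h2.unique ((hasDerivAt_id (0 : ℂ)).congr_of_eventuallyEq ?_)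
    filter_upwards [Metric.isOpen_ball.mem_nhds h0] with w hw using hKH w hw
  have hHn : ‖deriv H 0‖ = 1 := by
    have := congrArg norm hprod
    rw [norm_mul, norm_one] at this
    nlinarith [norm_nonneg (deriv H 0), norm_nonneg (deriv K 0)]
  -- The derivative is positive by the normalization, so it equals `1`.
  have hHone : deriv H 0 = 1 := by
    have e1 := (hHder 0 h0).deriv
    rw [hφ0] at e1
    have e2 := h.deriv_mul_deriv_inv ha
    rw [hfc] at e2
    have e3 : sphereDeriv g a = ((sphereDeriv g a).re : ℂ) := by
      apply Complex.ext <;> simp [him]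
    rw [eq_inv_of_mul_eq_one_right e2, e3] at e1
    have e4 : deriv H 0 = (((sphereDeriv g a).re * c⁻¹ : ℝ) : ℂ) := by
      rw [e1]; push_cast; rfl
    rw [e4, Complex.norm_real, Real.norm_of_nonneg (by positivity)] at hHn
    rw [e4, hHn, Complex.ofReal_one]
  have haff := Complex.affine_of_mapsTo_ball_of_norm_dslope_eq_div (R₂ := 1) hHd
    (by rw [hH0]; exact hHm.mono_right Metric.ball_subset_closedBall) h0
    (by rw [dslope_same, hHone]; simp)
  have := haff (h.maps hp)
  simp only [hH0, dslope_same, hHone, zero_add, sub_zero, smul_eq_mul, mul_one] at this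
  rw [← h.left_inv p hp, (hH _ (h.maps hp)).1, this, h.left_inv p hp]

end IsRiemannMap

/-- The components of a coordinatewise biholomorphic map onto the polydisc, normalized at `A`, are
conformal maps onto the disc. The coordinate `k` of the inverse map is restricted to the slice
through `0`, which is the image of the slice through `A`. -/
theorem exists_inverse_component {g : ℕ → Sphere → Sphere} {B : ℕ → Set Sphere} {A : SphereProd}
    (hA : A ∈ polycylinder B) (hg : IsBiholomorphic (coordMap g) (polycylinder B) unitPolydisc)
    (hgA : ∀ k, g k (A k) = ((0 : ℂ) : Sphere)) (k : ℕ) :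
    (∀ p ∈ B k, HolomorphicAtPt (g k) p) ∧ Set.MapsTo (g k) (B k) unitDisc ∧
      ∃ γ : Sphere → Sphere, (∀ s ∈ unitDisc, HolomorphicAtPt γ s) ∧
        Set.MapsTo γ unitDisc (B k) ∧ Set.InvOn γ (g k) (B k) unitDisc := by
  obtain ⟨hhol, G, hG, hGhol⟩ := hg
  let O : SphereProd := fun _ => ((0 : ℂ) : Sphere)
  have hO : O ∈ unitPolydisc := fun _ => coe_mem_unitDisc.2 (Metric.mem_ball_self one_pos)
  have hslice : ∀ t, coordMap g (A.replace k t) = O.replace k (g k t) := by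
    intro t
    funext j
    by_cases hj : j = k
    · subst hj
      simp only [coordMap, SphereProd.replace_self]
    · rw [SphereProd.replace_of_ne O hj]
      simp only [coordMap, SphereProd.replace_of_ne A hj, hgA, O]
  have hOs : ∀ s ∈ unitDisc, O.replace k s ∈ unitPolydisc := fun s hs =>
    replace_mem_polycylinder (B := fun _ => unitDisc) hO hs
  have hAp : ∀ p ∈ B k, A.replace k p ∈ polycylinder B := fun p hp =>
    replace_mem_polycylinder hA hp
  refine ⟨fun p hp => ?_, fun p hp => ?_, fun s => G (O.replace k s) k, fun s hs => ?_,
    fun s hs => hG.mapsTo_inv (hOs s hs) k, fun p hp => ?_, fun s hs => ?_⟩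
  · have := hhol.holomorphic _ (hAp p hp) k k
    simpa only [coordMap, SphereProd.replace_self] using this
  · have := hG.mapsTo (hAp p hp) k
    simpa only [coordMap, SphereProd.replace_self] using this
  · have := hGhol.holomorphic _ (hOs s hs) k k
    simpa only [SphereProd.replace_self, SphereProd.replace_replace] using this
  · simp only [← hslice, hG.invOn.1 (hAp p hp), SphereProd.replace_self]
  · have := congrFun (hG.invOn.2 (hOs s hs)) k
    simpa only [coordMap, SphereProd.replace_self] using this

end Polycylindrical

/-! ### Conformal maps of products of domains onto the polydisc -/

open Polycylindrical
theorem mainTheorem2 (δ : ℝ) (hδ : 0 < δ) (hδ' : δ ≤ 1) (A : SphereProd) (B : ℕ → Set Sphere)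
    (hA : A ∈ polycylinder B)
    (hB : ∀ k, IsHyperbolicType (B k))
    (hr : ∀ k, δ < innerRadius (B k) (A k) ∧ innerRadius (B k) (A k) < 1 / δ) :
    ∃ f : ℕ → Sphere → Sphere,
      (∀ k, UnivalentOn (f k) (B k) ∧ f k '' B k = unitDisc) ∧
      IsBiholomorphic (coordMap f) (polycylinder B) unitPolydisc ∧
      IsNormalizedAt f A ∧
      (∀ g : ℕ → Sphere → Sphere,
        IsBiholomorphic (coordMap g) (polycylinder B) unitPolydisc → IsNormalizedAt g A →
          Set.EqOn (coordMap g) (coordMap f) (polycylinder B)) ∧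
      (∀ G : SphereProd → SphereProd,
        IsInverseMap (coordMap f) G (polycylinder B) unitPolydisc → IsPartiallyConformal δ G) := by
  choose f φ h c hc hfc using fun k => exists_isRiemannMap_deriv_pos (hB k) (hA k)
  -- The inverse maps, with `coord 0` identifying the finite part of the sphere with `ℂ`.
  let Φ : ℕ → Sphere → Sphere := fun k s => φ k (coord ((0 : ℂ) : Sphere) s)
  have hΦ : ∀ k (w : ℂ), Φ k (w : Sphere) = φ k w := fun k w => by simp only [Φ, coord_zero_coe]
  refine ⟨fun k q => (f k q : Sphere), fun k => ⟨(h k).univalentOn, (h k).image_eq_unitDisc⟩,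
    ⟨holomorphicMapOn_coordMap (fun k p hp => (h k).continuousAt_coe hp)
      (fun k p hp => (h k).analyticAt_coord hp), coordMap Φ, ⟨?_, ?_, ?_, ?_⟩, ?_⟩, fun k => ?_,
    fun g hg hgA Z hZ => ?_, fun G hG => ⟨Φ, fun Z hZ => ?_, fun k => ⟨(h k).univalentOn_inv, ?_⟩⟩⟩
  · exact fun Z hZ k => coe_mem_unitDisc.2 ((h k).maps (hZ k))
  · intro W hW k
    obtain ⟨w, hw, e⟩ := hW k
    simp only [coordMap, ← e, hΦ]
    exact (h k).maps_inv hw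
  · intro Z hZ
    funext k
    simp only [coordMap, hΦ, (h k).left_inv _ (hZ k)]
  · intro W hW
    funext k
    obtain ⟨w, hw, e⟩ := hW k
    simp only [coordMap, ← e, hΦ, (h k).right_inv w hw]
  · exact holomorphicMapOn_coordMap (fun k p hp => (h k).continuousAt_inv_coord hp)
      (fun k p hp => (h k).analyticAt_inv_coord hp)
  · simp only [(h k).zero, (h k).sphereDeriv_coe, hfc k]
    exact ⟨trivial, by simpa using hc k, by simp⟩
  · funext k
    obtain ⟨h1, h2, γ, h3, h4, h5⟩ := exists_inverse_component hA hg (fun k => (hgA k).1) k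
    exact (h k).eq_of_normalized (hA k) (hc k) (hfc k) h1 h3 h2 h4 h5 (hgA k).1 (hgA k).2.1
      (hgA k).2.2 (hZ k)
  · funext k
    have h1 := congrFun (hG.invOn.2 hZ) k
    simp only [coordMap] at h1 ⊢
    rw [← h1, hΦ, (h k).left_inv _ (hG.mapsTo_inv hZ k)]
  · rw [(h k).norm_sphereDeriv_inv (hB k).isOpen (hA k)]
    exact hr k
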